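/- Fix countably infinite sets of state names and of function names. A $\mu$Stipula contract $C$ consists of an initial state $Q_{\rm init}$ and a finite sequence of functions $@Q\ f\,\{W\} \Rightarrow @Q'$, where $Q,Q'$ are states, $f$ is a function name and $W$ is a finite (possibly empty) sequence of events $\mathtt{now}+k \gg @P \Rightarrow @P'$ with $k\in\mathbb N$ and $P,P'$ states; a function is uniquely determined in $C$ by the triple $(Q,f,Q')$. The code is organized in lines and each event has its own line number $n$, its line-code. A configuration is a triple $(Q,\Sigma,\Psi)$ paired with a clock value $t\in\mathbb N$, where $Q$ is a state, $\Psi$ is a finite multiset of pending events $k\gg_n P\Rightarrow P'$ ($k\in\mathbb N$, $n$ a line-code), and $\Sigma$ is either empty ($-$) or a continuation $\Psi'\Rightarrow Q'$ with $\Psi'$ a finite multiset of pending events. Say that $\Psi$ is *idle in $Q$* if it contains no pending event $0\gg_n Q\Rightarrow Q'$. Let $\Psi{\downarrow}$ be obtained from $\Psi$ by deleting the pending events with time value $0$ and decreasing the time values of the others by $1$. The transitions of $C$ are: - (Function) $((Q,-,\Psi),t)\to((Q,\Psi'\Rightarrow Q',\Psi),t)$ if $@Q\ f\,\{W\}\Rightarrow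 @Q'$ is a function of $C$ and $\Psi$ is idle in $Q$, where $\Psi'$ is the multiset of the $k\gg_n P\Rightarrow P'$ for the events $\mathtt{now}+k\gg @P\Rightarrow @P'$ of $W$, with $n$ the line-code of the event; - (State-Change) $((Q,\Psi'\Rightarrow Q',\Psi),t)\to((Q',-,\Psi'\uplus\Psi),t)$; - (Event-Match) $((Q,-,\{0\gg_n Q\Rightarrow Q'\}\uplus\Psi'),t)\to((Q,\varnothing\Rightarrow Q',\Psi'),t)$; - (Tick) $((Q,-,\Psi),t)\to((Q,-,\Psi{\downarrow}),t+1)$ if $\Psi$ is idle in $Q$. A state $Q$ is *reachable* in $C$ if, for some $\Psi$ and $t$, the configuration $((Q,-,\Psi),t)$ can be reached from $((Q_{\rm init},-,\varnothing),0)$ by finitely many (possibly zero) transitions. The contract $C$ is *time-ahead* (belongs to $\mu$Stipula$^{\tt TA}$) if $k>0$ for every event $\mathtt{now}+k\gg @P\Rightarrow @P'$ in it. **Theorem.** State reachability is undecidable in $\mu$Stipula$^{\tt TA}$: there is no algorithm that, for every time-ahead contract $C$ and every state $Q$ given as input, terminates and answers correctly whether $Q$ is reachable in $C$. -/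

import Mathlib

namespace MuStipula

/-- States are drawn from a fixed countably infinite set of names. -/
abbrev State := ℕ

/-- Function names are drawn from a fixed countably infinite set of names. -/
abbrev FName := ℕ

/-- The event `now + delay >> @src => @tgt`. -/
structure Event where
  delay : ℕ
  src : State
  tgt : State

/-- The function `@src name { body } => @tgt`. -/
structure Fn where
  src : State
  name : FName
  body : List Event
  tgt : State

/-- The contract `stipula C { init start  functions }`. -/
structure Contract where
  start : State
  functions : List Fn

/-- A function is uniquely determined by its initial state, its name and its final state. -/
def Contract.WellFormed (C : Contract) : Prop :=
  (C.functions.map fun F => (F.src, F.name, F.tgt)).Nodup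

/-- The time-ahead fragment: every time expression is `now + k` with `k > 0`. -/
def Contract.TimeAhead (C : Contract) : Prop :=
  ∀ F ∈ C.functions, ∀ e ∈ F.body, 0 < e.delay

/-- A pending event `time >>_line src => tgt`, where `line` is a line-code. -/
structure Pending where
  time : ℕ
  line : ℕ
  src : State
  tgt : State

/-- The layout of a sequence of functions in lines of code, from line `l` on: every function is
paired with the line of its header, which is followed by one line for each of its events and by
one closing line. -/
def layout : ℕ → List Fn → List (ℕ × Fn)
  | _, [] => []
  | l, F :: Fs => (l, F) :: layout (l + F.body.length + 2) Fs

/-- The functions of a contract with the lines of their headers; the first two lines of the code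
hold the name of the contract and its initial state. -/
def Contract.code (C : Contract) : List (ℕ × Fn) := layout 3 C.functions

/-- The multiset of pending events that corresponds to the body `W` of a function whose header is
at line `l`: `now` is dropped and every event is tagged with its line-code. -/
def lineCode (l : ℕ) (W : List Event) : Multiset Pending :=
  ((W.zipIdx (l + 1)).map fun p => (⟨p.1.delay, p.2, p.1.src, p.1.tgt⟩ : Pending) : List Pending)

/-- No pending event can be triggered in state `Q`. -/
def NoRed (Ψ : Multiset Pending) (Q : State) : Prop :=
  ∀ e ∈ Ψ, ¬ (e.time = 0 ∧ e.src = Q)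

/-- The effect of a tick on one pending event: it is garbage-collected if its time value is `0`,
and otherwise its time value is decreased by one. -/
def Pending.tick : Pending → Option Pending
  | ⟨0, _, _, _⟩ => none
  | ⟨t + 1, n, Q, Q'⟩ => some ⟨t, n, Q, Q'⟩

/-- The effect of a tick on a multiset of pending events. -/
def down (Ψ : Multiset Pending) : Multiset Pending := Ψ.filterMap Pending.tick

/-- Configurations `C(state, cont, pending)` of a contract `C`. The component `cont` is either
empty (`none`) or a continuation `Ψ => Q` (`some (Ψ, Q)`). -/
structure Config where
  state : State
  cont : Option (Multiset Pending × State)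
  pending : Multiset Pending

/-- Labels of transitions: empty, the name of a function, or the line-code of an event. -/
inductive Label where
  | silent : Label
  | fn : FName → Label
  | ev : ℕ → Label

/-- The labelled transition relation of a contract between configurations paired with the value of
the clock. -/
inductive Step (C : Contract) : Config × ℕ → Label → Config × ℕ → Prop
  | function {l : ℕ} {F : Fn} {Ψ : Multiset Pending} {t : ℕ} :
      (l, F) ∈ C.code → NoRed Ψ F.src →
      Step C (⟨F.src, none, Ψ⟩, t) (.fn F.name)
        (⟨F.src, some (lineCode l F.body, F.tgt), Ψ⟩, t)
  | stateChange {Q Q' : State} {Ψ Ψ' : Multiset Pending} {t : ℕ} :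
      Step C (⟨Q, some (Ψ', Q'), Ψ⟩, t) .silent (⟨Q', none, Ψ' + Ψ⟩, t)
  | eventMatch {Q Q' : State} {n : ℕ} {Ψ' : Multiset Pending} {t : ℕ} :
      Step C (⟨Q, none, ⟨0, n, Q, Q'⟩ ::ₘ Ψ'⟩, t) (.ev n) (⟨Q, some (0, Q'), Ψ'⟩, t)
  | tick {Q : State} {Ψ : Multiset Pending} {t : ℕ} :
      NoRed Ψ Q →
      Step C (⟨Q, none, Ψ⟩, t) .silent (⟨Q, none, down Ψ⟩, t + 1)

/-- Computations: finite, possibly empty sequences of transitions. -/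
def Contract.Steps (C : Contract) : Config × ℕ → Config × ℕ → Prop :=
  Relation.ReflTransGen fun c c' => ∃ μ, Step C c μ c'

/-- The initial configuration: no continuation and no pending event. -/
def Contract.initial (C : Contract) : Config := ⟨C.start, none, 0⟩

/-- State reachability; the clock starts at `0`. -/
def Contract.Reachable (C : Contract) (Q : State) : Prop :=
  ∃ (Ψ : Multiset Pending) (t : ℕ), C.Steps (C.initial, 0) (⟨Q, none, Ψ⟩, t)

/-! Contracts as inputs of algorithms: they are encoded as tuples and lists of natural numbers. -/

def Event.equiv : Event ≃ ℕ × State × State where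
  toFun e := (e.delay, e.src, e.tgt)
  invFun p := ⟨p.1, p.2.1, p.2.2⟩

instance : Primcodable Event := Primcodable.ofEquiv _ Event.equiv

def Fn.equiv : Fn ≃ State × FName × List Event × State where
  toFun F := (F.src, F.name, F.body, F.tgt)
  invFun p := ⟨p.1, p.2.1, p.2.2.1, p.2.2.2⟩

instance : Primcodable Fn := Primcodable.ofEquiv _ Fn.equiv

def Contract.equiv : Contract ≃ State × List Fn where
  toFun C := (C.start, C.functions)
  invFun p := ⟨p.1, p.2⟩

instance : Primcodable Contract := Primcodable.ofEquiv _ Contract.equiv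

/-- The problem `p`, on the instances that satisfy `D`, is decidable: some algorithm terminates with
the right answer on every instance that satisfies `D`. Nothing is required of its behaviour on other
inputs. -/
def DecidableOn {α : Type*} [Primcodable α] (D p : α → Prop) : Prop :=
  ∃ f : α →. Bool, Partrec f ∧ ∀ a, D a → ∃ b ∈ f a, (b = true ↔ p a)

end MuStipula

open Function Relation

set_option linter.unusedSectionVars false

/-! The domain of a suitable partial recursive function is not computable, and it reduces to
reachability. The function is computed by a structured program over registers
(`Prog.exists_prog_dom`), and the program is run by a counter machine whose controls are the lists
of programs still to be executed (`Prog.exists_exec_iff`). It remains to simulate a counter machine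
by a contract whose events all have delay `1`. Such a contract has only events due now, `A`, and
events due after the next tick, `B`.

A register is represented by as many copies of a bundle of events, its unit, as its value. Events do
not survive their due time, so the phase of a control `c` consumes the units in `A` one at a time
and issues fresh ones into `B`. A due event blocks functions and ticks in its source state. Hence a
copying loop can be left by its exit function only when its register is exhausted, and an event at
`test c` forces the nonzero branch. Subtraction uses due events that fire instead of the function
that would renew a unit.

The contract may let time elapse too early. This loses units, but it also loses the event from `ret
c` to `sync`, the only exit of the phase. That event is issued only when `c` is made the next
control, and phase `c` never does so because no control is its own successor (`Prog.next_ne`). The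
contract is then trapped in the phase (`CounterMachine.Doomed.step`). Apart from such steps and
steps without effect the simulation is deterministic, and a phase performs exactly one instruction
(`CounterMachine.Ready.transGen`). So the final state is reached if and only if the machine halts
(`CounterMachine.exists_unitStep_iff`).

Line-codes and continuations are removed by `MuStipula.reachable_unitContract`. The input `n` occurs
only as the number of units issued by the first function, so the reduction is computable
(`MuStipula.primrec_contract`). -/

/-! ### Structured register programs -/

/-- Structured programs over registers indexed by `ℕ`; `loop i P` runs `P` as long as register `i`
is nonzero. -/
inductive Prog where
  | inc : ℕ → Prog
  | dec : ℕ → Prog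
  | seq : Prog → Prog → Prog
  | loop : ℕ → Prog → Prog
  deriving DecidableEq, Encodable

namespace Prog

/-- Big-step semantics. -/
inductive Exec : Prog → (ℕ → ℕ) → (ℕ → ℕ) → Prop
  | inc (i s) : Exec (inc i) s (update s i (s i + 1))
  | dec (i s) : Exec (dec i) s (update s i (s i - 1))
  | seq {P Q s t u} : Exec P s t → Exec Q t u → Exec (seq P Q) s u
  | loopDone {i P s} : s i = 0 → Exec (loop i P) s s
  | loopStep {i P s t u} : s i ≠ 0 → Exec P s t → Exec (loop i P) t u → Exec (loop i P) s u

/-- From `s`, the program `P` terminates, with `t` as its only result. -/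
def Det (P : Prog) (s t : ℕ → ℕ) : Prop := ∀ u, Exec P s u ↔ u = t

theorem Det.exec {P s t} (h : Det P s t) : Exec P s t := (h t).2 rfl

theorem exec_inc_iff {i s u} : Exec (inc i) s u ↔ u = update s i (s i + 1) :=
  ⟨fun h => by cases h; rfl, fun h => h ▸ .inc i s⟩

theorem exec_dec_iff {i s u} : Exec (dec i) s u ↔ u = update s i (s i - 1) :=
  ⟨fun h => by cases h; rfl, fun h => h ▸ .dec i s⟩

theorem exec_seq_iff {P Q s u} : Exec (seq P Q) s u ↔ ∃ t, Exec P s t ∧ Exec Q t u :=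
  ⟨fun h => by cases h with | seq h₁ h₂ => exact ⟨_, h₁, h₂⟩, fun ⟨_, h₁, h₂⟩ => .seq h₁ h₂⟩

theorem exec_loop_iff {i P s u} : Exec (loop i P) s u ↔
    (s i = 0 ∧ u = s) ∨ (s i ≠ 0 ∧ ∃ t, Exec P s t ∧ Exec (loop i P) t u) := by
  constructor
  · intro h
    cases h with
    | loopDone h => exact .inl ⟨h, rfl⟩
    | loopStep h h₁ h₂ => exact .inr ⟨h, _, h₁, h₂⟩
  · rintro (⟨h, rfl⟩ | ⟨h, t, h₁, h₂⟩)
    · exact .loopDone h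
    · exact .loopStep h h₁ h₂

theorem det_inc (i s) : Det (inc i) s (update s i (s i + 1)) := fun _ => exec_inc_iff

theorem det_dec (i s) : Det (dec i) s (update s i (s i - 1)) := fun _ => exec_dec_iff

theorem Det.seq_iff {P Q s t u} (h : Det P s t) : Exec (seq P Q) s u ↔ Exec Q t u := by
  rw [exec_seq_iff]
  exact ⟨fun ⟨v, hv, h'⟩ => (h v).1 hv ▸ h', fun h' => ⟨t, h.exec, h'⟩⟩

theorem Det.seq {P Q s t u} (h : Det P s t) (h' : Det Q t u) : Det (seq P Q) s u :=
  fun v => h.seq_iff.trans (h' v)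

theorem Det.of_eq {P s t u} (h : Det P s t) (e : t = u) : Det P s u := e ▸ h

theorem Det.loop_done {i P s} (h : s i = 0) : Det (loop i P) s s := fun u => by
  rw [exec_loop_iff]; simp [h]

theorem Det.loop_iff {i P s t u} (h : Det P s t) (hs : s i ≠ 0) :
    Exec (loop i P) s u ↔ Exec (loop i P) t u := by
  rw [exec_loop_iff]
  constructor
  · rintro (⟨h0, _⟩ | ⟨_, v, hv, h'⟩)
    · exact absurd h0 hs
    · exact (h v).1 hv ▸ h'
  · exact fun h' => .inr ⟨hs, t, h.exec, h'⟩

/-- A loop that counts register `i` down passes through a family of states indexed by the value of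
that register. -/
theorem det_loop_countdown {i P} (t : ℕ → ℕ → ℕ) (ht : ∀ k, t k i = k)
    (h : ∀ k, Det P (t (k + 1)) (t k)) (k : ℕ) : Det (loop i P) (t k) (t 0) := by
  induction k with
  | zero => exact .loop_done (ht 0)
  | succ k ih => exact fun u => ((h k).loop_iff (by rw [ht]; omega)).trans (ih u)

/-- The result of a loop whose body is deterministic along a sequence of states. -/
theorem exec_loop_search {i P} (t : ℕ → ℕ → ℕ) (h : ∀ k, Det P (t k) (t (k + 1))) {u : ℕ → ℕ} :
    Exec (loop i P) (t 0) u ↔ ∃ k, t k i = 0 ∧ (∀ m < k, t m i ≠ 0) ∧ u = t k := by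
  constructor
  · intro H
    -- The program and the start are generalized for the induction on `Exec`; `k` counts the passes
    -- already made.
    have key : ∀ Q s u, Exec Q s u → Q = loop i P → ∀ k, s = t k → (∀ m < k, t m i ≠ 0) →
        ∃ k, t k i = 0 ∧ (∀ m < k, t m i ≠ 0) ∧ u = t k := by
      intro Q s u H
      induction H with
      | inc | dec | seq => intro h; cases h
      | loopDone h0 =>
        rintro ⟨⟩ k rfl hk
        exact ⟨k, h0, hk, rfl⟩
      | loopStep h0 h₁ _ _ ih =>
        rintro ⟨⟩ k rfl hk
        refine ih rfl (k + 1) ((h k _).1 h₁) fun m hm => ?_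
        rcases Nat.lt_succ_iff_lt_or_eq.1 hm with hm | rfl
        exacts [hk m hm, h0]
    exact key _ _ _ H rfl 0 rfl (by simp)
  · rintro ⟨k, hk, hlt, rfl⟩
    -- Built backwards from the exit: `m` counts the passes that remain.
    have : ∀ m ≤ k, Exec (loop i P) (t (k - m)) (t k) := by
      intro m
      induction m with
      | zero => intro _; exact .loopDone hk
      | succ m ih =>
        intro hm
        have e : k - (m + 1) + 1 = k - m := by omega
        exact .loopStep (hlt _ (by omega)) (h _).exec (e ▸ ih (by omega))
    simpa using this k le_rfl

/-- The program without effect. -/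
def skip : Prog := seq (inc 0) (dec 0)

theorem det_skip (s) : Det skip s s :=
  ((det_inc _ _).seq (det_dec _ _)).of_eq (by simp)

/-- Set register `i` to zero. -/
def clear (i : ℕ) : Prog := loop i (dec i)

theorem det_clear (i s) : Det (clear i) s (update s i 0) := by
  have := det_loop_countdown (i := i) (P := dec i) (fun k => update s i k) (by simp)
    (fun k => (det_dec _ _).of_eq (by simp)) (s i)
  simpa [clear] using this

/-- Copy register `i` to register `j`, with `k` as scratch. -/
def copy (i j k : ℕ) : Prog :=
  seq (clear j) (seq (loop i (seq (dec i) (seq (inc j) (inc k)))) (loop k (seq (dec k) (inc i))))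

theorem det_copy {i j k : ℕ} (hij : i ≠ j) (hik : i ≠ k) (hjk : j ≠ k) {s : ℕ → ℕ} (hk : s k = 0) :
    Det (copy i j k) s (update s j (s i)) := by
  refine (det_clear j s).seq (.seq (t := update (update (update s i 0) j (s i)) k (s i)) ?_ ?_)
  -- Registers `i` and `j` always sum to `s i`. With truncated subtraction this makes sense only up
  -- to `s i`, so `det_loop_countdown`, which asks for all `k`, does not apply.
  · have step := fun m (hm : m < s i) => show Det (seq (dec i) (seq (inc j) (inc k)))
        (update (update (update s i (m + 1)) j (s i - (m + 1))) k (s i - (m + 1)))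
        (update (update (update s i m) j (s i - m)) k (s i - m)) from
      ((det_dec _ _).seq ((det_inc _ _).seq (det_inc _ _))).of_eq (by
        funext r
        simp only [update_apply]
        split_ifs <;> omega)
    have : ∀ m ≤ s i, Det (loop i (seq (dec i) (seq (inc j) (inc k))))
        (update (update (update s i m) j (s i - m)) k (s i - m))
        (update (update (update s i 0) j (s i)) k (s i)) := by
      intro m
      induction m with
      | zero => intro _; exact .loop_done (by simp [hij, hik])
      | succ m ih =>
        exact fun hm u => ((step m (by omega)).loop_iff (by simp [hij, hik])).trans
          (ih (by omega) u)
    have := this (s i) le_rfl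
    refine cast ?_ this
    congr 1
    funext r
    simp only [update_apply]
    split_ifs <;> simp_all
  · have step := fun m => show Det (seq (dec k) (inc i))
        (update (update (update s i (s i - (m + 1))) j (s i)) k (m + 1))
        (update (update (update s i (s i - (m + 1) + 1)) j (s i)) k m) from
      ((det_dec _ _).seq (det_inc _ _)).of_eq (by
        funext r
        simp only [update_apply]
        split_ifs <;> omega)
    have : ∀ m ≤ s i, Det (loop k (seq (dec k) (inc i)))
        (update (update (update s i (s i - m)) j (s i)) k m) (update s j (s i)) := by
      intro m
      induction m with
      | zero =>
        intro _
        refine (Det.loop_done (by simp)).of_eq ?_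
        funext r
        simp only [update_apply]
        split_ifs <;> simp_all
      | succ m ih =>
        intro hm u
        have e : s i - (m + 1) + 1 = s i - m := by omega
        exact ((e ▸ step m).loop_iff (by simp)).trans (ih (by omega) u)
    have := this (s i) le_rfl
    simpa using this

/-- Store a list in the registers from `c` on. -/
def put (c : ℕ) : List ℕ → (ℕ → ℕ) → ℕ → ℕ
  | [], s => s
  | a :: l, s => put (c + 1) l (update s c a)

theorem put_of_lt {c r : ℕ} {l s} (h : r < c) : put c l s r = s r := by
  induction l generalizing c s with
  | nil => rfl
  | cons a l ih => rw [put, ih (by omega), update_of_ne (by omega)]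

theorem put_of_le {c r : ℕ} {l s} (h : c + l.length ≤ r) : put c l s r = s r := by
  induction l generalizing c s with
  | nil => rfl
  | cons a l ih =>
    simp only [List.length_cons] at h
    rw [put, ih (by omega), update_of_ne (by omega)]

theorem put_add {c i : ℕ} {l s} (h : i < l.length) : put c l s (c + i) = l[i] := by
  induction l generalizing c s i with
  | nil => simp at h
  | cons a l ih =>
    cases i with
    | zero => rw [put, put_of_lt (by omega)]; simp
    | succ i =>
      rw [put, show c + (i + 1) = c + 1 + i by omega, ih (by simpa using h)]
      simp

/-- Set `m` registers from `c` on to zero. -/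
def clears : ℕ → ℕ → Prog
  | _, 0 => skip
  | c, m + 1 => seq (clear c) (clears (c + 1) m)

theorem det_clears (c m s) : Det (clears c m) s (put c (List.replicate m 0) s) := by
  induction m generalizing c s with
  | zero => exact det_skip s
  | succ m ih => exact (det_clear c s).seq (ih _ _)

theorem put_zero_put {c : ℕ} {l s} (h : ∀ r ≥ c, s r = 0) :
    put c (List.replicate l.length 0) (put c l s) = s := by
  funext r
  by_cases h₁ : r < c
  · rw [put_of_lt h₁, put_of_lt h₁]
  · by_cases h₂ : r < c + l.length
    · obtain ⟨i, rfl⟩ := Nat.exists_eq_add_of_le (not_lt.1 h₁)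
      rw [put_add (by simpa using h₂), h _ (by omega)]
      simp
    · rw [put_of_le (by simpa using h₂), put_of_le (by simpa using h₂)]

/-- The vector of the contents of some registers. -/
def read {n : ℕ} (s : ℕ → ℕ) (ins : Fin n → ℕ) : List.Vector ℕ n :=
  List.Vector.ofFn fun i => s (ins i)

theorem read_congr {n : ℕ} {s t : ℕ → ℕ} {ins : Fin n → ℕ} (h : ∀ i, s (ins i) = t (ins i)) :
    read s ins = read t ins := by
  unfold read; congr 1; funext i; exact h i

theorem read_cons {n : ℕ} (s : ℕ → ℕ) (a : ℕ) (ins : Fin n → ℕ) :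
    read s (Fin.cons a ins : Fin (n + 1) → ℕ) = s a ::ᵥ read s ins := rfl

theorem read_succ {n : ℕ} (s : ℕ → ℕ) (ins : Fin (n + 1) → ℕ) :
    read s ins = s (ins 0) ::ᵥ read s fun i => ins i.succ := rfl

/-! ### Partial recursive functions by programs -/

/-- The partial function `f` can be computed for every choice of the input registers, of the output
register and of a bound `b` from which on all registers are free, and hold `0`. -/
def Implements {n : ℕ} (f : List.Vector ℕ n →. ℕ) : Prop :=
  ∀ (ins : Fin n → ℕ) (out b : ℕ), (∀ i, ins i < b) → out < b → (∀ i, ins i ≠ out) →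
    ∃ P : Prog, ∀ s : ℕ → ℕ, (∀ r ≥ b, s r = 0) →
      ∀ u, Exec P s u ↔ ∃ y ∈ f (read s ins), u = update s out y

theorem implements_of_total {n : ℕ} {f : List.Vector ℕ n → ℕ}
    (h : ∀ (ins : Fin n → ℕ) (out b : ℕ), (∀ i, ins i < b) → out < b → (∀ i, ins i ≠ out) →
      ∃ P : Prog, ∀ s : ℕ → ℕ, (∀ r ≥ b, s r = 0) → Det P s (update s out (f (read s ins)))) :
    Implements (PFun.lift f) := by
  intro ins out b h₁ h₂ h₃
  obtain ⟨P, hP⟩ := h ins out b h₁ h₂ h₃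
  refine ⟨P, fun s hs u => (hP s hs u).trans ?_⟩
  simp

theorem Implements.total {n : ℕ} {f : List.Vector ℕ n → ℕ}
    (h : Implements (PFun.lift f)) (ins : Fin n → ℕ) (out b : ℕ)
    (h₁ : ∀ i, ins i < b) (h₂ : out < b) (h₃ : ∀ i, ins i ≠ out) :
    ∃ P : Prog, ∀ s : ℕ → ℕ, (∀ r ≥ b, s r = 0) → Det P s (update s out (f (read s ins))) := by
  obtain ⟨P, hP⟩ := h ins out b h₁ h₂ h₃
  refine ⟨P, fun s hs u => (hP s hs u).trans ?_⟩
  simp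

theorem implements_zero : Implements (PFun.lift fun _ : List.Vector ℕ 0 => 0) :=
  implements_of_total fun _ out _ _ _ _ => ⟨clear out, fun s _ => det_clear out s⟩

theorem implements_get {n : ℕ} (i : Fin n) :
    Implements (PFun.lift fun v : List.Vector ℕ n => v.get i) :=
  implements_of_total fun ins out b h₁ h₂ h₃ => ⟨copy (ins i) out b, fun s hs =>
    (det_copy (h₃ i) (h₁ i).ne h₂.ne (hs b le_rfl)).of_eq (by simp [read])⟩

theorem implements_succ :
    Implements (PFun.lift fun v : List.Vector ℕ 1 => Nat.succ v.head) :=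
  implements_of_total fun ins out b h₁ h₂ h₃ => ⟨seq (copy (ins 0) out b) (inc out), fun s hs =>
    ((det_copy (h₃ 0) (h₁ 0).ne h₂.ne (hs b le_rfl)).seq (det_inc _ _)).of_eq
      (by simp [read_succ])⟩

/-- The inputs lie below `b ≤ c` and the results are written from `c` on, so every component still
reads the original inputs. The scratch space from `d` on is clear of all results. -/
theorem exists_prog_mOfFn {k : ℕ} {ins : Fin k → ℕ} {b : ℕ} (hb : ∀ i, ins i < b) {m : ℕ}
    (g : Fin m → List.Vector ℕ k →. ℕ) (hg : ∀ i, Implements (g i)) (c d : ℕ) (hc : b ≤ c)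
    (hd : c + m ≤ d) :
    ∃ P : Prog, ∀ s : ℕ → ℕ, (∀ r ≥ d, s r = 0) → ∀ u, Exec P s u ↔
      ∃ y ∈ List.Vector.mOfFn fun i => g i (read s ins), u = put c y.toList s := by
  induction m generalizing c with
  | zero =>
    refine ⟨skip, fun s _ u => (det_skip s u).trans ?_⟩
    simp [List.Vector.mOfFn, pure, put]
  | succ m ih =>
    obtain ⟨P, hP⟩ := hg 0 ins c d (fun i => (hb i).trans_le (by omega)) (by omega)
      (fun i => ((hb i).trans_le hc).ne)
    obtain ⟨Q, hQ⟩ := ih (fun i => g i.succ) (fun i => hg _) (c + 1) (by omega) (by omega)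
    refine ⟨seq P Q, fun s hs u => ?_⟩
    have hr : ∀ a, read (update s c a) ins = read s ins := fun a =>
      read_congr fun i => update_of_ne ((hb i).trans_le hc).ne _ _
    have hQ' : ∀ a, Exec Q (update s c a) u ↔ _ := fun a => hQ (update s c a) (fun r hr => by
      rw [update_of_ne (by omega), hs r hr]) u
    simp only [hr] at hQ'
    simp only [exec_seq_iff, hP s hs, List.Vector.mOfFn, Part.bind_eq_bind, Part.mem_bind_iff,
      Part.pure_eq_some, Part.mem_some_iff]
    constructor
    · rintro ⟨_, ⟨a, ha, rfl⟩, h⟩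
      obtain ⟨y, hy, rfl⟩ := (hQ' a).1 h
      exact ⟨_, ⟨a, ha, y, hy, rfl⟩, by simp [put]⟩
    · rintro ⟨_, ⟨a, ha, y, hy, rfl⟩, rfl⟩
      exact ⟨_, ⟨a, ha, rfl⟩, (hQ' a).2 ⟨y, hy, by simp [put]⟩⟩

/-- The intermediate values are parked in the `n` registers from `b` on and cleared at the end,
since only `out` may differ in the final state. -/
theorem Implements.comp {m n : ℕ} {f : List.Vector ℕ n →. ℕ} {g : Fin n → List.Vector ℕ m →. ℕ}
    (hf : Implements f) (hg : ∀ i, Implements (g i)) :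
    Implements fun v => (List.Vector.mOfFn fun i => g i v) >>= f := by
  intro ins out b h₁ h₂ h₃
  obtain ⟨P, hP⟩ := exists_prog_mOfFn h₁ g hg b (b + n) le_rfl le_rfl
  obtain ⟨Q, hQ⟩ := hf (fun i => b + i) out (b + n) (by simp) (by omega) (fun i => by omega)
  refine ⟨seq P (seq Q (clears b n)), fun s hs u => ?_⟩
  have key : ∀ y : List.Vector ℕ n, Exec (seq Q (clears b n)) (put b y.toList s) u ↔
      ∃ z ∈ f y, u = update s out z := by
    intro y
    have hr : read (put b y.toList s) (fun i : Fin n => b + i) = y := by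
      apply List.Vector.ext
      intro i
      rw [read, List.Vector.get_ofFn, put_add (by simp)]
      simp [List.Vector.get_eq_get_toList]
    have h0 : ∀ z, put b (List.replicate n 0) (update (put b y.toList s) out z) =
        update s out z := by
      intro z
      funext r
      by_cases hr : r = out
      · subst hr
        rw [put_of_lt h₂]; simp
      · have h := congrFun (put_zero_put (l := y.toList) hs) r
        simp only [List.Vector.toList_length] at h
        rw [update_of_ne hr, ← h]
        by_cases h₁ : r < b
        · rw [put_of_lt h₁, put_of_lt h₁, update_of_ne hr]
        · by_cases h₂ : r < b + n
          · obtain ⟨i, rfl⟩ := Nat.exists_eq_add_of_le (not_lt.1 h₁)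
            rw [put_add (by simpa using h₂), put_add (by simpa using h₂)]
          · rw [put_of_le (by simpa using h₂), put_of_le (by simpa using h₂), update_of_ne hr]
    have hQ' := fun v => hQ (put b y.toList s) (fun r hr => by
      rw [put_of_le (by simpa using hr), hs r (by omega)]) v
    simp only [hr] at hQ'
    rw [exec_seq_iff]
    simp only [hQ', det_clears b n _ _]
    constructor
    · rintro ⟨_, ⟨z, hz, rfl⟩, rfl⟩
      exact ⟨z, hz, h0 z⟩
    · rintro ⟨z, hz, rfl⟩
      exact ⟨_, ⟨z, hz, rfl⟩, (h0 z).symm⟩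
  have hP' := fun v => hP s (fun r hr => hs r (by omega)) v
  rw [exec_seq_iff]
  simp only [hP']
  constructor
  · rintro ⟨_, ⟨y, hy, rfl⟩, h⟩
    obtain ⟨z, hz, rfl⟩ := (key y).1 h
    exact ⟨z, Part.mem_bind_iff.2 ⟨y, hy, hz⟩, rfl⟩
  · rintro ⟨z, h, rfl⟩
    obtain ⟨y, hy, hz⟩ := Part.mem_bind_iff.1 h
    exact ⟨_, ⟨y, hy, rfl⟩, (key y).2 ⟨z, hz, rfl⟩⟩

theorem Implements.of_eq {n : ℕ} {f g : List.Vector ℕ n →. ℕ} (hf : Implements f)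
    (h : ∀ v, f v = g v) : Implements g := funext h ▸ hf

/-- Register `b` counts the remaining rounds, `b + 1` holds the recursion index and `b + 2` the
current value. The next value is computed into `b + 3`, because an output register may not be an
input, and then moved; `b + 4` is scratch for copying. -/
theorem Implements.prec {n : ℕ} {f : List.Vector ℕ n → ℕ} {g : List.Vector ℕ (n + 2) → ℕ}
    (hf : Implements (PFun.lift f)) (hg : Implements (PFun.lift g)) :
    Implements (PFun.lift fun v : List.Vector ℕ (n + 1) =>
      v.head.rec (f v.tail) fun y IH => g (y ::ᵥ IH ::ᵥ v.tail)) := by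
  refine implements_of_total fun ins out b h₁ h₂ h₃ => ?_
  set tl : Fin n → ℕ := fun i => ins i.succ
  have htl : ∀ i, tl i < b := fun i => h₁ _
  obtain ⟨P, hP⟩ := hf.total tl (b + 2) (b + 4) (fun i => by have := htl i; omega) (by omega)
    (fun i => by have := htl i; omega)
  obtain ⟨Q, hQ⟩ := hg.total (Fin.cons (b + 1) (Fin.cons (b + 2) tl)) (b + 3) (b + 4)
    (fun i => by
      refine Fin.cases (by simp) (fun i => ?_) i
      refine Fin.cases (by simp) (fun i => ?_) i
      have := htl i; simp; omega) (by omega)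
    (fun i => by
      refine Fin.cases (by simp) (fun i => ?_) i
      refine Fin.cases (by simp) (fun i => ?_) i
      have := htl i; simp; omega)
  refine ⟨seq (copy (ins 0) b (b + 4)) (seq P (seq (loop b (seq (dec b) (seq Q
    (seq (copy (b + 3) (b + 2) (b + 4)) (seq (clear (b + 3)) (inc (b + 1)))))))
    (seq (copy (b + 2) out (b + 4)) (seq (clear (b + 1)) (clear (b + 2)))))), fun s hs => ?_⟩
  set N := s (ins 0)
  set R : ℕ → ℕ := fun y =>
    Nat.rec (f (read s tl)) (fun y IH => g (y ::ᵥ IH ::ᵥ read s tl)) y with hR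
  have hR1 : ∀ y, R (y + 1) = g (y ::ᵥ R y ::ᵥ read s tl) := fun y => rfl
  let t : ℕ → ℕ → ℕ := fun k =>
    update (update (update s b k) (b + 1) (N - k)) (b + 2) (R (N - k))
  have hi0 := h₁ 0
  have htr : ∀ (u : ℕ → ℕ), (∀ r < b, u r = s r) → read u tl = read s tl := fun u hu =>
    read_congr fun i => hu _ (htl i)
  have init : Det P (update s b N) (t N) := by
    refine (hP _ fun r hr => ?_).of_eq ?_
    · rw [update_of_ne (by omega), hs r (by omega)]
    · rw [htr _ (fun r hr => by rw [update_of_ne (by omega)])]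
      funext r
      simp only [t, update_apply, Nat.sub_self]
      split_ifs <;> first | rfl | omega | (subst_vars; simp [hs])
  have step : ∀ k < N, Det (seq (dec b) (seq Q (seq (copy (b + 3) (b + 2) (b + 4))
      (seq (clear (b + 3)) (inc (b + 1)))))) (t (k + 1)) (t k) := by
    intro k hk
    refine (det_dec _ _).seq ((hQ _ fun r hr => ?_).seq ((det_copy (by omega) (by omega)
      (by omega) ?_).seq ((det_clear _ _).seq (det_inc _ _)))) |>.of_eq ?_
    · simp only [t, update_apply]
      rw [if_neg (by omega), if_neg (by omega), if_neg (by omega), if_neg (by omega),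
        hs r (by omega)]
    · simp only [t, update_apply]
      simp [hs]
    · rw [read_cons, read_cons, htr _ (fun r hr => by
        simp only [t, update_apply]
        rw [if_neg (by omega), if_neg (by omega), if_neg (by omega), if_neg (by omega)])]
      have e : N - k = N - (k + 1) + 1 := by omega
      funext r
      simp only [t, e, hR1]
      simp only [update_apply]
      have : s (b + 3) = 0 := hs _ (by omega)
      split_ifs <;> first | rfl | omega | (subst_vars; simp_all)
  have lp : ∀ k ≤ N, Det (loop b (seq (dec b) (seq Q (seq (copy (b + 3) (b + 2) (b + 4))
      (seq (clear (b + 3)) (inc (b + 1))))))) (t k) (t 0) := by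
    intro k
    induction k with
    | zero => intro _; exact .loop_done (by simp [t])
    | succ k ih =>
      exact fun hk u => ((step k (by omega)).loop_iff (by simp [t])).trans (ih (by omega) u)
  refine (det_copy (by omega) (by omega) (by omega) (hs _ (by omega))).seq (init.seq
    ((lp N le_rfl).seq ((det_copy (by omega) (by omega) (by omega) ?_).seq
      ((det_clear _ _).seq (det_clear _ _))))) |>.of_eq ?_
  · simp [t, hs]
  · rw [read_succ]
    funext r
    simp only [List.Vector.head_cons, List.Vector.tail_cons]
    simp only [t, update_apply, Nat.sub_zero]
    have e0 : s b = 0 := hs _ (by omega)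
    have e1 : s (b + 1) = 0 := hs _ (by omega)
    have e2 : s (b + 2) = 0 := hs _ (by omega)
    split_ifs <;> first | rfl | omega | (subst_vars; simp_all)

/-- Register `b` holds the candidate and `b + 1` the value of `f` there, so the loop on `b + 1`
stops exactly at the first zero of `f`, and diverges if there is none. -/
theorem Implements.rfind {n : ℕ} {f : List.Vector ℕ (n + 1) → ℕ} (hf : Implements (PFun.lift f)) :
    Implements fun v => Nat.rfind fun n => Part.some (decide (f (n ::ᵥ v) = 0)) := by
  intro ins out b h₁ h₂ h₃
  obtain ⟨P, hP⟩ := hf.total (Fin.cons b ins) (b + 1) (b + 2)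
    (fun i => by
      refine Fin.cases (by simp) (fun i => ?_) i
      have := h₁ i; simp; omega) (by omega)
    (fun i => by
      refine Fin.cases (by simp) (fun i => ?_) i
      have := h₁ i; simp; omega)
  refine ⟨seq P (seq (loop (b + 1) (seq (inc b) P)) (seq (copy b out (b + 2)) (clear b))),
    fun s hs u => ?_⟩
  let t : ℕ → ℕ → ℕ := fun k => update (update s b k) (b + 1) (f (k ::ᵥ read s ins))
  -- The old content `x` of the output register is irrelevant, so the same fact serves the first
  -- evaluation and all later ones.
  have hP' : ∀ k x, Det P (update (update s b k) (b + 1) x) (t k) := by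
    intro k x
    refine (hP _ fun r hr => ?_).of_eq ?_
    · rw [update_of_ne (by omega), update_of_ne (by omega), hs r (by omega)]
    · rw [read_cons, read_congr (t := s) (fun i => by
        have := h₁ i
        rw [update_of_ne (by omega), update_of_ne (by omega)])]
      simp [t]
  have init : Det P s (t 0) := by
    have := hP' 0 0
    rwa [show update (update s b 0) (b + 1) 0 = s from ?_] at this
    funext r
    simp only [update_apply]
    split_ifs <;> first | rfl | (subst_vars; simp [hs])
  have step : ∀ k, Det (seq (inc b) P) (t k) (t (k + 1)) := by
    intro k
    refine (det_inc _ _).seq ?_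
    convert hP' (k + 1) (f (k ::ᵥ read s ins)) using 1
    funext r
    simp only [t, update_apply]
    split_ifs <;> first | rfl | omega
  have fin : ∀ k, t k (b + 1) = 0 →
      Det (seq (copy b out (b + 2)) (clear b)) (t k) (update s out k) := by
    intro k hk
    refine ((det_copy (by omega) (by omega) (by omega) ?_).seq (det_clear _ _)).of_eq ?_
    · simp [t, hs]
    · simp only [t, update_self] at hk
      simp only [t, hk]
      funext r
      have e0 : s b = 0 := hs _ (by omega)
      have e1 : s (b + 1) = 0 := hs _ (by omega)
      simp only [update_apply]
      split_ifs <;> first | rfl | omega | (subst_vars; simp_all)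
  rw [init.seq_iff, exec_seq_iff]
  simp only [exec_loop_search t step]
  have ht : ∀ k, t k (b + 1) = f (k ::ᵥ read s ins) := fun k => by simp [t]
  constructor
  · rintro ⟨_, ⟨k, h0, hlt, rfl⟩, h⟩
    refine ⟨k, Nat.mem_rfind.2 ⟨?_, fun {m} hm => ?_⟩, (fin k h0 u).1 h⟩
    · rw [ht] at h0; simp [h0]
    · have := hlt m hm; rw [ht] at this; simp [this]
  · rintro ⟨k, h, rfl⟩
    obtain ⟨h0, hlt⟩ := Nat.mem_rfind.1 h
    have h0' : t k (b + 1) = 0 := by rw [ht]; simpa using h0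
    refine ⟨_, ⟨k, h0', fun m hm => ?_, rfl⟩, (fin k h0').exec⟩
    rw [ht]
    simpa using hlt hm

theorem implements_of_primrec' {n : ℕ} {f : List.Vector ℕ n → ℕ} (hf : Nat.Primrec' f) :
    Implements (PFun.lift f) := by
  induction hf with
  | zero => exact implements_zero
  | succ => exact implements_succ
  | get i => exact implements_get i
  | comp g _ _ hf hg =>
    refine (hf.comp hg).of_eq fun v => ?_
    simp only [PFun.coe_val, Vector.mOfFn_part_some]
    exact Part.bind_some _ _
  | prec _ _ hf hg => exact hf.prec hg

theorem implements_of_partrec' {n : ℕ} {f : List.Vector ℕ n →. ℕ} (hf : Nat.Partrec' f) :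
    Implements f := by
  induction hf with
  | prim hf => exact implements_of_primrec' hf
  | comp _ _ _ hf hg => exact hf.comp hg
  | rfind _ hf => exact hf.rfind

/-- Every partial recursive function on `ℕ` has a program that, started with the argument in
register `0` and zeros elsewhere, terminates exactly on the domain of the function. -/
theorem exists_prog_dom {f : ℕ →. ℕ} (hf : Partrec f) :
    ∃ P : Prog, ∀ n, (∃ u, Exec P (update 0 0 n) u) ↔ (f n).Dom := by
  obtain ⟨P, hP⟩ := implements_of_partrec' (Nat.Partrec'.part_iff₁.2 hf) (fun _ => 0) 1 2
    (by simp) (by simp) (by simp)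
  refine ⟨P, fun n => ?_⟩
  have h := hP (update 0 0 n) (fun r hr => by rw [update_of_ne (by omega)]; rfl)
  simp only [h, read_succ, List.Vector.head_cons, update_self]
  rw [Part.dom_iff_mem]
  exact ⟨fun ⟨_, y, hy, _⟩ => ⟨y, hy⟩, fun ⟨y, hy⟩ => ⟨_, y, hy, rfl⟩⟩

end Prog

/-! ### Counter machines -/

/-- An instruction of a counter machine: test register `reg` for zero in order to choose the next
control, then subtract `sub` from it (truncated) and add `add`. -/
structure Instr (Λ : Type*) where
  reg : ℕ
  sub : ℕ
  add : ℕ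
  zero : Λ
  pos : Λ

namespace Instr

variable {Λ : Type*}

/-- The control after an instruction. -/
def next (I : Instr Λ) (s : ℕ → ℕ) : Λ := if s I.reg = 0 then I.zero else I.pos

/-- The registers after an instruction. -/
def upd (I : Instr Λ) (s : ℕ → ℕ) : ℕ → ℕ := update s I.reg (s I.reg - I.sub + I.add)

theorem next_of_eq {I : Instr Λ} (h : I.zero = I.pos) (s : ℕ → ℕ) : I.next s = I.zero := by
  unfold next; split_ifs <;> simp [h]

theorem next_of_zero {I : Instr Λ} {s : ℕ → ℕ} (h : s I.reg = 0) : I.next s = I.zero := if_pos h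

theorem next_of_ne_zero {I : Instr Λ} {s : ℕ → ℕ} (h : s I.reg ≠ 0) : I.next s = I.pos := if_neg h

/-- The transitions of the counter machine that executes the instruction `M c` in control `c`, as
long as `c` is not the control `halt`. -/
def Next (M : Λ → Instr Λ) (halt : Λ) (x y : Λ × (ℕ → ℕ)) : Prop :=
  x.1 ≠ halt ∧ y = ((M x.1).next x.2, (M x.1).upd x.2)

end Instr

namespace Prog

/-- The counter machine whose controls are the lists of programs that remain to be run. -/
def instr : List Prog → Instr (List Prog)
  | [] => ⟨0, 0, 0, [], []⟩
  | inc i :: k => ⟨i, 0, 1, k, k⟩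
  | dec i :: k => ⟨i, 1, 0, k, k⟩
  | seq P Q :: k => ⟨0, 0, 0, P :: Q :: k, P :: Q :: k⟩
  | loop i P :: k => ⟨i, 0, 0, k, P :: loop i P :: k⟩

/-- Big-step semantics of lists of programs. -/
def ExecList : List Prog → (ℕ → ℕ) → (ℕ → ℕ) → Prop
  | [], s, u => s = u
  | P :: k, s, u => ∃ t, Exec P s t ∧ ExecList k t u

theorem next_inc (i k s) : ((instr (inc i :: k)).next s, (instr (inc i :: k)).upd s) =
    (k, update s i (s i + 1)) := by
  rw [Instr.next_of_eq rfl]; rfl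

theorem next_dec (i k s) : ((instr (dec i :: k)).next s, (instr (dec i :: k)).upd s) =
    (k, update s i (s i - 1)) := by
  rw [Instr.next_of_eq rfl]; rfl

theorem next_seq (P Q k s) : ((instr (seq P Q :: k)).next s, (instr (seq P Q :: k)).upd s) =
    (P :: Q :: k, s) := by
  rw [Instr.next_of_eq rfl]; simp [instr, Instr.upd]

theorem next_loop_done {i s} (h : s i = 0) (P k) :
    ((instr (loop i P :: k)).next s, (instr (loop i P :: k)).upd s) = (k, s) := by
  rw [Instr.next_of_zero h, Instr.upd]; simp [instr]

theorem next_loop_step {i s} (h : s i ≠ 0) (P k) :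
    ((instr (loop i P :: k)).next s, (instr (loop i P :: k)).upd s) = (P :: loop i P :: k, s) := by
  rw [Instr.next_of_ne_zero h, Instr.upd]; simp [instr]

/-- Big-step results are pulled back along one machine step, so a halting run can be read from its
end to its start. -/
theorem execList_of_next {x y : List Prog × (ℕ → ℕ)} {u : ℕ → ℕ} (h : Instr.Next instr [] x y)
    (hy : ExecList y.1 y.2 u) : ExecList x.1 x.2 u := by
  obtain ⟨c, s⟩ := x
  obtain ⟨hc, rfl⟩ := h
  match c, hc with
  | inc i :: k, _ => rw [next_inc] at hy; exact ⟨_, .inc i s, hy⟩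
  | dec i :: k, _ => rw [next_dec] at hy; exact ⟨_, .dec i s, hy⟩
  | seq P Q :: k, _ =>
    rw [next_seq] at hy
    obtain ⟨t, ht, t', ht', h⟩ := hy
    exact ⟨t', .seq ht ht', h⟩
  | loop i P :: k, _ =>
    by_cases h0 : s i = 0
    · rw [next_loop_done h0] at hy
      exact ⟨s, .loopDone h0, hy⟩
    · rw [next_loop_step h0] at hy
      obtain ⟨t, ht, t', ht', h⟩ := hy
      exact ⟨t', .loopStep h0 ht ht', h⟩

theorem next_of_exec {P : Prog} {s t : ℕ → ℕ} (h : Exec P s t) (k : List Prog) :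
    Relation.ReflTransGen (Instr.Next instr []) (P :: k, s) (k, t) := by
  induction h generalizing k with
  | inc i s => exact .single ⟨by simp, (next_inc i k s).symm⟩
  | dec i s => exact .single ⟨by simp, (next_dec i k s).symm⟩
  | seq _ _ ih₁ ih₂ =>
    exact .head ⟨by simp, (next_seq _ _ k _).symm⟩ ((ih₁ _).trans (ih₂ _))
  | loopDone h0 => exact .single ⟨by simp, (next_loop_done h0 _ k).symm⟩
  | loopStep h0 _ _ ih₁ ih₂ =>
    exact .head ⟨by simp, (next_loop_step h0 _ k).symm⟩ ((ih₁ _).trans (ih₂ _))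

theorem exists_exec_iff {P : Prog} {s : ℕ → ℕ} : (∃ u, Exec P s u) ↔
    ∃ u, Relation.ReflTransGen (Instr.Next instr []) ([P], s) ([], u) := by
  refine exists_congr fun u => ⟨fun h => next_of_exec h [], fun h => ?_⟩
  have key : ExecList [P] s u := by
    refine Relation.ReflTransGen.head_induction_on
      (motive := fun (x : List Prog × (ℕ → ℕ)) _ => ExecList x.1 x.2 u) h ?_
      fun h _ ih => execList_of_next h ih
    exact rfl
  obtain ⟨t, ht, rfl⟩ := key
  exact ht

/-- The controls that are reached while `P` is run, with the list `k` to be run afterwards. -/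
def support : Prog → List Prog → Finset (List Prog)
  | inc i, k => {inc i :: k}
  | dec i, k => {dec i :: k}
  | seq P Q, k => insert (seq P Q :: k) (support P (Q :: k) ∪ support Q k)
  | loop i P, k => insert (loop i P :: k) (support P (loop i P :: k))

theorem mem_support_self (P : Prog) (k : List Prog) : P :: k ∈ support P k := by
  cases P <;> simp [support]

/-- Closure of `support` under successors: this is what makes the machine of a program finite. -/
theorem next_mem_support (P : Prog) (k : List Prog) : ∀ c ∈ support P k,
    ((instr c).zero ∈ support P k ∨ (instr c).zero = k) ∧
    ((instr c).pos ∈ support P k ∨ (instr c).pos = k) := by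
  induction P generalizing k with
  | inc i => simp [support, instr]
  | dec i => simp [support, instr]
  | seq P Q ihP ihQ =>
    intro c hc
    have hP := mem_support_self P (Q :: k)
    have hQ := mem_support_self Q k
    simp only [support, Finset.mem_insert, Finset.mem_union] at hc ⊢
    rcases hc with rfl | hc | hc
    · simp [instr, hP]
    · have := ihP _ c hc
      constructor
      · rcases this.1 with h | h
        · exact .inl (.inr (.inl h))
        · exact .inl (.inr (.inr (h ▸ hQ)))
      · rcases this.2 with h | h
        · exact .inl (.inr (.inl h))
        · exact .inl (.inr (.inr (h ▸ hQ)))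
    · have := ihQ _ c hc
      tauto
  | loop i P ih =>
    intro c hc
    have hP := mem_support_self P (loop i P :: k)
    simp only [support, Finset.mem_insert] at hc ⊢
    rcases hc with rfl | hc
    · simp [instr, hP]
    · have := ih _ c hc
      tauto

theorem ne_nil_of_mem_support {P : Prog} {k c : List Prog} (h : c ∈ support P k) : c ≠ [] := by
  induction P generalizing k with
  | inc i => simp_all [support]
  | dec i => simp_all [support]
  | seq P Q ihP ihQ =>
    simp only [support, Finset.mem_insert, Finset.mem_union] at h
    rcases h with rfl | h | h
    exacts [by simp, ihP h, ihQ h]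
  | loop i P ih =>
    simp only [support, Finset.mem_insert] at h
    rcases h with rfl | h
    exacts [by simp, ih h]

/-- Every instruction makes the list of remaining programs longer or shorter by one. The simulation
depends on this: a phase must never issue its own exit event. -/
theorem next_ne {c : List Prog} (h : c ≠ []) : (instr c).zero ≠ c ∧ (instr c).pos ≠ c := by
  match c, h with
  | inc i :: k, _ => simp [instr]
  | dec i :: k, _ => simp [instr]
  | seq P Q :: k, _ =>
    have h : P :: Q :: k ≠ Prog.seq P Q :: k := fun h => by
      have := congrArg List.length h; simp at this
    exact ⟨h, h⟩
  | loop i P :: k, _ =>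
    have h : P :: loop i P :: k ≠ loop i P :: k := fun h => by
      have := congrArg List.length h; simp at this
    exact ⟨by simp [instr], h⟩

end Prog

/-! ### The simulating contract and its traps -/

/-- The transitions of a contract all of whose events have delay `1`. A configuration consists of
the state, the events `src => tgt` of time `0`, and those of time `1`; a function is given by its
initial state, its events and its final state. -/
inductive UnitStep {σ : Type*} (F : List (σ × List (σ × σ) × σ)) :
    σ × Multiset (σ × σ) × Multiset (σ × σ) → σ × Multiset (σ × σ) × Multiset (σ × σ) → Prop
  | fn {Q W Q' A B} : (Q, W, Q') ∈ F → (∀ t ∈ A, t.1 ≠ Q) →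
      UnitStep F (Q, A, B) (Q', A, (W : Multiset (σ × σ)) + B)
  | ev {Q Q' A B} : UnitStep F (Q, (Q, Q') ::ₘ A, B) (Q', A, B)
  | tick {Q A B} : (∀ t ∈ A, t.1 ≠ Q) → UnitStep F (Q, A, B) (Q, B, 0)

/-- A counter machine with finitely many controls, none of which is its own successor, and finitely
many registers. -/
structure CounterMachine (Λ : Type*) where
  instr : Λ → Instr Λ
  controls : List Λ
  bound : ℕ
  halt : Λ
  nodup : controls.Nodup
  halt_notMem : halt ∉ controls
  reg_lt : ∀ c ∈ controls, (instr c).reg < bound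
  bound_pos : 0 < bound
  zero_mem : ∀ c ∈ controls, (instr c).zero ∈ controls ∨ (instr c).zero = halt
  pos_mem : ∀ c ∈ controls, (instr c).pos ∈ controls ∨ (instr c).pos = halt
  zero_ne : ∀ c ∈ controls, (instr c).zero ≠ c
  pos_ne : ∀ c ∈ controls, (instr c).pos ≠ c

/-- The states of the contract that simulates a counter machine. During the phase of a control `c`,
the contract consumes the events that represent the counters and renews them, one counter after the
other (`loop c j` and `got c j`); then it tests the register of the instruction (`test c` and
`pos c`), and it checks in `ret c` that time has not elapsed. -/
inductive SimState (Λ : Type*) where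
  | init : SimState Λ
  | sync : SimState Λ
  | ret : Λ → SimState Λ
  | loop : Λ → ℕ → SimState Λ
  | got : Λ → ℕ → SimState Λ
  | test : Λ → SimState Λ
  | pos : Λ → SimState Λ
  deriving DecidableEq

namespace SimState

variable {Λ : Type*}

/-- The control in whose phase a state occurs. -/
def phase : SimState Λ → Option Λ
  | init => none
  | sync => none
  | ret c => some c
  | loop c _ => some c
  | got c _ => some c
  | test c => some c
  | pos c => some c

/-- The target of the events with a given source, other than `sync`. -/
def target : SimState Λ → SimState Λ
  | init => init
  | sync => sync
  | ret _ => sync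
  | loop c j => got c j
  | got c j => loop c j
  | test c => pos c
  | pos c => pos c

end SimState

theorem Multiset.coe_flatten_replicate {α : Type*} (n : ℕ) (l : List α) :
    ((List.replicate n l).flatten : Multiset α) = n • (l : Multiset α) := by
  induction n with
  | zero => simp
  | succ n ih => rw [List.replicate_succ, List.flatten_cons, ← Multiset.coe_add, ih, succ_nsmul']

namespace CounterMachine

open SimState

variable {Λ : Type*} [DecidableEq Λ] (M : CounterMachine Λ)

/-- The events that represent a unit of the register `j`. -/
def unit (j : ℕ) : List (SimState Λ × SimState Λ) :=
  M.controls.map (fun c => (loop c j, got c j)) ++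
    (M.controls.filter fun c => (M.instr c).reg = j).map fun c => (test c, pos c)

/-- The events, besides those of the registers, that are used in the phase of control `c`: the check
that time has not elapsed, and those that suppress the renewal of units that are subtracted. -/
def aux (c : Λ) : List (SimState Λ × SimState Λ) :=
  (ret c, sync) :: List.replicate (M.instr c).sub (got c (M.instr c).reg, loop c (M.instr c).reg)

/-- The events that make `c` the next control. -/
def control (c : Λ) : List (SimState Λ × SimState Λ) := (sync, loop c 0) :: M.aux c

/-- The functions for the phase of control `c`. -/
def phaseFns (c : Λ) : List (SimState Λ × List (SimState Λ × SimState Λ) × SimState Λ) :=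
  ((List.range M.bound).flatMap fun j =>
    [(loop c j, if j = (M.instr c).reg then (List.replicate (M.instr c).add (M.unit j)).flatten
        else [], loop c (j + 1)),
      (got c j, M.unit j, loop c j)]) ++
  [(loop c M.bound, [], test c), (test c, M.control (M.instr c).zero, ret c),
    (pos c, M.control (M.instr c).pos, ret c)]

/-- The functions of the contract that simulates `M` from control `c₀` and `n` in register `0`. -/
def fns (c₀ : Λ) (n : ℕ) : List (SimState Λ × List (SimState Λ × SimState Λ) × SimState Λ) :=
  (init, (List.replicate n (M.unit 0)).flatten ++ M.control c₀, sync) ::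
    M.controls.flatMap M.phaseFns

theorem mem_fns {c₀ : Λ} {n : ℕ} {Q W Q'} : (Q, W, Q') ∈ M.fns c₀ n ↔
    (Q = init ∧ W = (List.replicate n (M.unit 0)).flatten ++ M.control c₀ ∧ Q' = sync) ∨
    ∃ c ∈ M.controls,
      (∃ j < M.bound, Q = loop c j ∧ W = (if j = (M.instr c).reg then
        (List.replicate (M.instr c).add (M.unit j)).flatten else []) ∧ Q' = loop c (j + 1)) ∨
      (∃ j < M.bound, Q = got c j ∧ W = M.unit j ∧ Q' = loop c j) ∨
      (Q = loop c M.bound ∧ W = [] ∧ Q' = test c) ∨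
      (Q = test c ∧ W = M.control (M.instr c).zero ∧ Q' = ret c) ∨
      (Q = pos c ∧ W = M.control (M.instr c).pos ∧ Q' = ret c) := by
  simp only [fns, phaseFns, List.mem_cons, List.mem_flatMap, List.mem_append, List.mem_range,
    Prod.mk.injEq, List.not_mem_nil, or_false]
  refine or_congr_right (exists_congr fun c => and_congr_right fun _ => ?_)
  constructor
  · rintro (⟨j, hj, h | h⟩ | h)
    · exact .inl ⟨j, hj, h⟩
    · exact .inr (.inl ⟨j, hj, h⟩)
    · exact .inr (.inr h)
  · rintro (⟨j, hj, h⟩ | ⟨j, hj, h⟩ | h)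
    · exact .inl ⟨j, hj, .inl h⟩
    · exact .inl ⟨j, hj, .inr h⟩
    · exact .inr h

/-- No event of `B` lets the contract leave the phase of control `c`. -/
def Stuck (c : Λ) (B : Multiset (SimState Λ × SimState Λ)) : Prop :=
  ∀ t ∈ B, t.1 ≠ ret c ∧ (t.1.phase = some c → t.2.phase = some c)

theorem Stuck.add {c : Λ} {A B} (hA : Stuck c A) (hB : Stuck c B) : Stuck c (A + B) :=
  fun t ht => (Multiset.mem_add.1 ht).elim (hA t) (hB t)

theorem Stuck.nsmul {c : Λ} {A} (hA : Stuck c A) (n : ℕ) : Stuck c (n • A) :=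
  fun t ht => hA t (Multiset.mem_of_mem_nsmul ht)

theorem stuck_zero (c : Λ) : Stuck c 0 := by simp [Stuck]

theorem stuck_unit (c : Λ) (j : ℕ) : Stuck c (M.unit j) := by
  intro t ht
  simp only [unit, Multiset.mem_coe, List.mem_append, List.mem_map] at ht
  rcases ht with ⟨c', _, rfl⟩ | ⟨c', _, rfl⟩ <;> simp [phase]

/-- Making `c'` the next control issues the exit event of phase `c'` alone; for `c' = c` it would
open the trap. -/
theorem stuck_control {c c' : Λ} (h : c' ≠ c) : Stuck c (M.control c') := by
  intro t ht
  simp only [control, aux, Multiset.mem_coe, List.mem_cons, List.mem_replicate] at ht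
  rcases ht with rfl | rfl | ⟨_, rfl⟩ <;> simp [phase, h]

/-- The configurations from which the contract cannot leave the phase of its control. -/
def Doomed (x : SimState Λ × Multiset (SimState Λ × SimState Λ) ×
    Multiset (SimState Λ × SimState Λ)) : Prop :=
  ∃ c, c ≠ M.halt ∧ x.1.phase = some c ∧ Stuck c x.2.1 ∧ Stuck c x.2.2

theorem stuck_of_mem_fns {c₀ c : Λ} {n : ℕ} {Q W Q'} (h : (Q, W, Q') ∈ M.fns c₀ n)
    (hQ : Q.phase = some c) : Q'.phase = some c ∧ Stuck c W := by
  rw [mem_fns] at h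
  rcases h with ⟨rfl, -, -⟩ | ⟨c', hc', ⟨j, _, rfl, rfl, rfl⟩ | ⟨j, _, rfl, rfl, rfl⟩ |
    ⟨rfl, rfl, rfl⟩ | ⟨rfl, rfl, rfl⟩ | ⟨rfl, rfl, rfl⟩⟩
  · simp [phase] at hQ
  all_goals
    obtain rfl : c' = c := by simpa [phase] using hQ
    refine ⟨rfl, ?_⟩
  · split_ifs
    · rw [Multiset.coe_flatten_replicate]
      exact (M.stuck_unit _ _).nsmul _
    · exact stuck_zero _
  · exact M.stuck_unit _ _
  · exact stuck_zero _
  · exact M.stuck_control (M.zero_ne _ hc')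
  · exact M.stuck_control (M.pos_ne _ hc')

variable {M}

/-- A lost exit is never restored: functions of the phase issue only stuck events, due events stay
in the phase, and a tick merely turns `B` into the due events. -/
theorem Doomed.step {c₀ : Λ} {n : ℕ} {x y} (hx : M.Doomed x) (h : UnitStep (M.fns c₀ n) x y) :
    M.Doomed y := by
  obtain ⟨c, hc, hQ, hA, hB⟩ := hx
  cases h with
  | fn hf _ =>
    obtain ⟨h₁, h₂⟩ := M.stuck_of_mem_fns hf hQ
    exact ⟨c, hc, h₁, hA, h₂.add hB⟩
  | ev =>
    exact ⟨c, hc, (hA _ (Multiset.mem_cons_self _ _)).2 hQ,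
      fun t ht => hA t (Multiset.mem_cons_of_mem ht), hB⟩
  | tick _ => exact ⟨c, hc, hQ, hB, stuck_zero c⟩

theorem Doomed.ne {x} (hx : M.Doomed x) : x.1 ≠ loop M.halt 0 := by
  obtain ⟨c, hc, hQ, -⟩ := hx
  intro h
  rw [h] at hQ
  exact hc (by simpa [phase] using hQ.symm)

/-! ### Almost deterministic steps -/

variable (M) in
/-- A step from a configuration, not in the final state, whose other steps have no effect or lead to
doomed configurations. -/
def MainStep (c₀ : Λ) (n : ℕ) (x y : SimState Λ × Multiset (SimState Λ × SimState Λ) ×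
    Multiset (SimState Λ × SimState Λ)) : Prop :=
  UnitStep (M.fns c₀ n) x y ∧ x.1 ≠ loop M.halt 0 ∧
    ∀ z, UnitStep (M.fns c₀ n) x z → z = y ∨ z = x ∨ M.Doomed z

variable {c₀ : Λ} {n : ℕ}

/-- A due event at `Q` blocks all functions and the tick, and `h'` leaves a single target. -/
theorem mainStep_ev {Q Q' : SimState Λ} {A B} (hQ : Q ≠ loop M.halt 0) (h : (Q, Q') ∈ A)
    (h' : ∀ t ∈ A, t.1 = Q → t.2 = Q') : M.MainStep c₀ n (Q, A, B) (Q', A.erase (Q, Q'), B) := by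
  refine ⟨?_, hQ, fun z hz => .inl ?_⟩
  · conv in (Q, A, B) => rw [← Multiset.cons_erase h]
    exact .ev
  · generalize hx : (Q, A, B) = x at hz
    cases hz with
    | fn _ hn | tick hn =>
      cases hx
      exact absurd rfl (hn _ h)
    | ev =>
      cases hx
      obtain rfl := h' _ (Multiset.mem_cons_self _ _) rfl
      simp

/-- The only rival of the function is a tick. By `hB` it either leads to a doomed configuration or,
when there are no events at all, changes nothing; the latter case is needed before the start of the
simulation. -/
theorem mainStep_fn {Q Q' : SimState Λ} {A B W} (hQ : Q ≠ loop M.halt 0) (hA : ∀ t ∈ A, t.1 ≠ Q)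
    (h : (Q, W, Q') ∈ M.fns c₀ n)
    (h' : ∀ W' Q'', (Q, W', Q'') ∈ M.fns c₀ n → W' = W ∧ Q'' = Q')
    (hB : M.Doomed (Q, B, 0) ∨ A = 0 ∧ B = 0) :
    M.MainStep c₀ n (Q, A, B) (Q', A, (W : Multiset _) + B) := by
  refine ⟨.fn h hA, hQ, fun z hz => ?_⟩
  generalize hx : (Q, A, B) = x at hz
  cases hz with
  | fn hf _ =>
    cases hx
    obtain ⟨rfl, rfl⟩ := h' _ _ hf
    exact .inl rfl
  | ev =>
    cases hx
    exact absurd rfl (hA _ (Multiset.mem_cons_self _ _))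
  | tick _ =>
    cases hx
    rcases hB with hB | ⟨rfl, rfl⟩
    exacts [.inr (.inr hB), .inr (.inl rfl)]

theorem mainStep_tick {Q : SimState Λ} {A B} (hQ : Q ≠ loop M.halt 0) (hA : ∀ t ∈ A, t.1 ≠ Q)
    (h : ∀ W Q', (Q, W, Q') ∉ M.fns c₀ n) : M.MainStep c₀ n (Q, A, B) (Q, B, 0) := by
  refine ⟨.tick hA, hQ, fun z hz => .inl ?_⟩
  generalize hx : (Q, A, B) = x at hz
  cases hz with
  | fn hf _ =>
    cases hx
    exact absurd hf (h _ _)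
  | ev =>
    cases hx
    exact absurd rfl (hA _ (Multiset.mem_cons_self _ _))
  | tick _ =>
    cases hx
    rfl

/-- The number of events with a given source. -/
def profile (A : Multiset (SimState Λ × SimState Λ)) (Q : SimState Λ) : ℕ :=
  A.countP fun t => t.1 = Q

/-- The targets of the events are determined by their sources. -/
def Typed (A : Multiset (SimState Λ × SimState Λ)) : Prop :=
  ∀ t ∈ A, t.1 ≠ sync → t.2 = t.1.target

theorem profile_eq_zero {A : Multiset (SimState Λ × SimState Λ)} {Q : SimState Λ} :
    profile A Q = 0 ↔ ∀ t ∈ A, t.1 ≠ Q := by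
  simp [profile, Multiset.countP_eq_zero]

theorem profile_add (A B : Multiset (SimState Λ × SimState Λ)) (Q : SimState Λ) :
    profile (A + B) Q = profile A Q + profile B Q := Multiset.countP_add _ _ _

theorem profile_nsmul (k : ℕ) (A : Multiset (SimState Λ × SimState Λ)) (Q : SimState Λ) :
    profile (k • A) Q = k * profile A Q := Multiset.countP_nsmul _ _ _

/-- In a typed multiset the due events at `Q` share one target, so it does not matter which of them
fires, and the numbers in `profile` are all that has to be tracked. -/
theorem exists_mainStep_ev {Q : SimState Λ} {A B} {m : ℕ} (hQ : Q ≠ loop M.halt 0)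
    (hs : Q ≠ sync) (hA : Typed A) (h : profile A Q = m + 1) :
    ∃ A', M.MainStep c₀ n (Q, A, B) (Q.target, A', B) ∧ Typed A' ∧ profile A' Q = m ∧
      ∀ R, R ≠ Q → profile A' R = profile A R := by
  obtain ⟨⟨a, b⟩, ht, rfl⟩ : ∃ t ∈ A, t.1 = Q := Multiset.countP_pos.1 (by
    change 0 < profile A Q
    omega)
  obtain rfl : b = a.target := hA _ ht hs
  obtain ⟨A', rfl⟩ := Multiset.exists_cons_of_mem ht
  refine ⟨A', ?_, fun t ht => hA t (Multiset.mem_cons_of_mem ht), ?_, fun R hR => ?_⟩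
  · simpa using mainStep_ev (B := B) hQ ht fun t ht h => by
      rw [hA t ht (by rwa [h]), h]
  · simpa [profile] using h
  · simp [profile, hR.symm]

theorem Typed.add {A B : Multiset (SimState Λ × SimState Λ)} (hA : Typed A) (hB : Typed B) :
    Typed (A + B) :=
  fun t ht => (Multiset.mem_add.1 ht).elim (hA t) (hB t)

theorem typed_unit (j : ℕ) : Typed (M.unit j : Multiset (SimState Λ × SimState Λ)) := by
  intro t ht
  simp only [unit, Multiset.mem_coe, List.mem_append, List.mem_map] at ht
  rcases ht with ⟨c', _, rfl⟩ | ⟨c', _, rfl⟩ <;> simp [target]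

theorem typed_aux (c : Λ) : Typed (M.aux c : Multiset (SimState Λ × SimState Λ)) := by
  intro t ht
  simp only [aux, Multiset.mem_coe, List.mem_cons, List.mem_replicate] at ht
  rcases ht with rfl | ⟨_, rfl⟩ <;> simp [target]

variable (M) in
/-- The events that represent the values of the registers below `k`. -/
def regs (k : ℕ) (s : ℕ → ℕ) : Multiset (SimState Λ × SimState Λ) :=
  ∑ j ∈ Finset.range k, s j • (M.unit j : Multiset (SimState Λ × SimState Λ))

theorem mem_regs {k : ℕ} {s : ℕ → ℕ} {t} (h : t ∈ M.regs k s) : ∃ j, t ∈ M.unit j := by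
  obtain ⟨j, _, h⟩ := Multiset.mem_sum.1 h
  exact ⟨j, Multiset.mem_of_mem_nsmul h⟩

theorem typed_regs (k : ℕ) (s : ℕ → ℕ) : Typed (M.regs k s) := fun t ht =>
  let ⟨j, hj⟩ := mem_regs ht; typed_unit j t hj

theorem stuck_regs (c : Λ) (k : ℕ) (s : ℕ → ℕ) : Stuck c (M.regs k s) := fun t ht =>
  let ⟨j, hj⟩ := mem_regs ht; M.stuck_unit c j t hj

theorem profile_regs (k : ℕ) (s : ℕ → ℕ) (Q : SimState Λ) :
    profile (M.regs k s) Q = ∑ j ∈ Finset.range k, s j * profile (M.unit j) Q := by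
  unfold regs
  induction k with
  | zero => simp [profile]
  | succ k ih => rw [Finset.sum_range_succ, Finset.sum_range_succ, profile_add, ih, profile_nsmul]

/-- The controls are listed without repetition, so a unit carries one copying event for each of
them, and counting those events recovers the value of the register. -/
theorem profile_unit_loop {c : Λ} (hc : c ∈ M.controls) (i j : ℕ) :
    profile (M.unit i) (loop c j) = if i = j then 1 else 0 := by
  have := List.count_eq_one_of_mem M.nodup hc
  simp only [profile, unit, Multiset.coe_countP, List.countP_append, List.countP_map]
  split_ifs with h
  · subst h
    simpa [List.count, Function.comp_def, List.countP_eq_zero, BEq.beq] using this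
  · simp [h, Function.comp_def]

theorem profile_unit_test {c : Λ} (hc : c ∈ M.controls) (i : ℕ) :
    profile (M.unit i) (test c) = if i = (M.instr c).reg then 1 else 0 := by
  simp only [profile, unit, Multiset.coe_countP, List.countP_append, List.countP_map]
  split_ifs with h
  · have := List.count_eq_one_of_mem (M.nodup.filter fun c => (M.instr c).reg = i)
      (List.mem_filter.2 ⟨hc, by simp [h]⟩)
    simpa [List.count, Function.comp_def, List.countP_eq_zero, BEq.beq] using this
  · simp [Function.comp_def, List.countP_eq_zero]
    rintro c' _ h' rfl
    exact h h'.symm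

theorem profile_unit_eq_zero (i : ℕ) {Q : SimState Λ} (h₁ : ∀ c j, Q ≠ loop c j)
    (h₂ : ∀ c, Q ≠ test c) : profile (M.unit i) Q = 0 := by
  rw [profile_eq_zero]
  intro t ht
  simp only [unit, Multiset.mem_coe, List.mem_append, List.mem_map] at ht
  rcases ht with ⟨c', _, rfl⟩ | ⟨c', _, rfl⟩
  exacts [(h₁ _ _).symm, (h₂ _).symm]

end CounterMachine

/-! ### Correctness of the simulation -/

namespace CounterMachine

open SimState

variable {Λ : Type*} [DecidableEq Λ] {M : CounterMachine Λ} {c₀ : Λ} {n : ℕ}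

theorem ne_halt {c : Λ} (hc : c ∈ M.controls) : c ≠ M.halt := fun h => M.halt_notMem (h ▸ hc)

theorem loop_ne_halt {c : Λ} (hc : c ∈ M.controls) (j : ℕ) : loop c j ≠ loop M.halt 0 := by
  simp [ne_halt hc]

/-- A premature tick replaces the due events by `B`, which contains no exit of the phase, and so it
dooms the contract. -/
theorem mainStep_phase {c : Λ} {Q Q' : SimState Λ} {A B W} (hc : c ∈ M.controls)
    (hQ : Q.phase = some c) (hA : profile A Q = 0) (h : (Q, W, Q') ∈ M.fns c₀ n)
    (h' : ∀ W' Q'', (Q, W', Q'') ∈ M.fns c₀ n → W' = W ∧ Q'' = Q') (hB : Stuck c B) :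
    M.MainStep c₀ n (Q, A, B) (Q', A, (W : Multiset _) + B) := by
  refine mainStep_fn ?_ (profile_eq_zero.1 hA) h h' (.inl ⟨c, ne_halt hc, hQ, hB, stuck_zero c⟩)
  rintro rfl
  exact ne_halt hc (by simpa [phase] using hQ.symm)

/-- The copying loop for the register `j`; it renews one unit less for each of the events
`got c j => loop c j`. -/
theorem exists_copy {c : Λ} (hc : c ∈ M.controls) {j : ℕ} (hj : j < M.bound) (m : ℕ) :
    ∀ (d : ℕ) {A B}, Typed A → profile A (loop c j) = m → profile A (got c j) = d → Stuck c B →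
      ∃ A', ReflTransGen (M.MainStep c₀ n) (loop c j, A, B)
          (loop c j, A', (m - d) • (M.unit j : Multiset _) + B) ∧
        Typed A' ∧ profile A' (loop c j) = 0 ∧
        ∀ Q, Q ≠ loop c j → Q ≠ got c j → profile A' Q = profile A Q := by
  induction m with
  | zero => exact fun d A B hA hm _ _ => ⟨A, by simpa using .refl, hA, hm, fun _ _ _ => rfl⟩
  | succ m ih =>
    intro d A B hA hm hd hB
    obtain ⟨A₁, h₁, hA₁, hm₁, hp₁⟩ := exists_mainStep_ev (M := M) (c₀ := c₀) (n := n) (B := B)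
      (loop_ne_halt hc j) (by simp) hA hm
    rw [← hp₁ _ (by simp)] at hd
    -- With no suppressing event due at `got c j`, the function there renews the unit; otherwise
    -- such an event preempts the function and the unit is lost.
    cases d with
    | zero =>
      have h₂ : M.MainStep c₀ n (got c j, A₁, B)
          (loop c j, A₁, (M.unit j : Multiset _) + B) := by
        refine mainStep_phase hc rfl hd (M.mem_fns.2 (.inr ⟨c, hc, .inr (.inl ⟨j, hj, ?_⟩)⟩))
          (fun W' Q'' h => ?_) hB
        · simp
        · simpa [mem_fns, hc, hj] using h
      obtain ⟨A', h, hA', hm', hp'⟩ := ih 0 hA₁ hm₁ hd ((M.stuck_unit c j).add hB)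
      refine ⟨A', .head h₁ (.head h₂ ?_), hA', hm', fun Q hQ hQ' => ?_⟩
      · convert h using 3
        simp only [Nat.sub_zero, succ_nsmul, add_assoc]
      · rw [hp' Q hQ hQ', hp₁ Q hQ]
    | succ d =>
      obtain ⟨A₂, h₂, hA₂, hd₂, hp₂⟩ := exists_mainStep_ev (M := M) (c₀ := c₀) (n := n) (B := B)
        (by simp) (by simp) hA₁ hd
      rw [← hp₂ _ (by simp)] at hm₁
      obtain ⟨A', h, hA', hm', hp'⟩ := ih d hA₂ hm₁ hd₂ hB
      refine ⟨A', .head h₁ (.head h₂ ?_), hA', hm', fun Q hQ hQ' => ?_⟩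
      · rwa [Nat.add_sub_add_right]
      · rw [hp' Q hQ hQ', hp₂ Q hQ', hp₁ Q hQ]

variable (M) in
/-- At the start of the phase of `c`, the events `A` represent the registers `s`. -/
structure Ready (c : Λ) (s : ℕ → ℕ) (A : Multiset (SimState Λ × SimState Λ)) : Prop where
  typed : Typed A
  loop : ∀ j < M.bound, profile A (loop c j) = s j
  got : ∀ j < M.bound,
    profile A (got c j) = if j = (M.instr c).reg then (M.instr c).sub else 0
  loop_bound : profile A (SimState.loop c M.bound) = 0
  test : profile A (test c) = s (M.instr c).reg
  pos : profile A (pos c) = 0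
  ret : profile A (ret c) = 1
  sync : profile A sync = 0

/-- Registers are renewed one after the other. The register of the instruction loses `sub` units in
its copying loop and gains `add` units from the function that leaves it; events of states not yet
visited remain untouched. -/
theorem Ready.exists_loop {c : Λ} (hc : c ∈ M.controls) {s : ℕ → ℕ} {A} (hA : M.Ready c s A) (k : ℕ)
    (hk : k ≤ M.bound) : ∃ A', ReflTransGen (M.MainStep c₀ n) (SimState.loop c 0, A, 0)
        (SimState.loop c k, A', M.regs k ((M.instr c).upd s)) ∧ Typed A' ∧
      ∀ Q, (∀ j < k, Q ≠ SimState.loop c j ∧ Q ≠ SimState.got c j) → profile A' Q = profile A Q := by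
  induction k with
  | zero => exact ⟨A, .refl, hA.typed, fun _ _ => rfl⟩
  | succ k ih =>
    obtain ⟨A₁, h₁, hA₁, hp₁⟩ := ih (by omega)
    have hl := hp₁ (SimState.loop c k) (fun j hj => by simp [hj.ne'])
    have hg := hp₁ (SimState.got c k) (fun j hj => by simp [hj.ne'])
    rw [hA.loop k hk] at hl
    rw [hA.got k hk] at hg
    obtain ⟨A₂, h₂, hA₂, hm₂, hp₂⟩ := exists_copy (c₀ := c₀) (n := n) hc hk _ _ hA₁ hl hg
      (stuck_regs c k ((M.instr c).upd s))
    refine ⟨A₂, (h₁.trans h₂).tail ?_, hA₂, fun Q hQ => ?_⟩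
    · have hS : Stuck c ((s k - if k = (M.instr c).reg then (M.instr c).sub else 0) •
          (M.unit k : Multiset _) + M.regs k ((M.instr c).upd s)) :=
        ((M.stuck_unit c k).nsmul _).add (stuck_regs _ _ _)
      have h₃ := mainStep_phase (c₀ := c₀) (n := n) hc rfl hm₂
        (M.mem_fns.2 (.inr ⟨c, hc, .inl ⟨k, hk, rfl, rfl, rfl⟩⟩)) (fun W' Q'' h => by
          -- The function from `loop c M.bound` to `test c` is thereby excluded, so the exit from
          -- `loop c k` is unique.
          have hkb : k ≠ M.bound := by omega
          simpa [mem_fns, hc, Nat.lt_of_succ_le hk, hkb] using h) hS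
      convert h₃ using 3
      rw [regs, Finset.sum_range_succ, ← regs, Instr.upd, update_apply]
      split_ifs with h
      · rw [Multiset.coe_flatten_replicate, h, add_nsmul]
        abel
      · simp [add_comm]
    · have := hQ k (by omega)
      rw [hp₂ Q this.1 this.2, hp₁ Q fun j hj => hQ j (by omega)]

/-- No function starts in `sync`, so time has to elapse there; afterwards the event naming the next
control is the only one that is due at `sync`. -/
theorem mainStep_enter (c : Λ) {A B} (hA : profile A sync = 0) (hB : profile B sync = 0) :
    ReflTransGen (M.MainStep c₀ n) (sync, A, (M.control c : Multiset _) + B)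
      (loop c 0, (M.aux c : Multiset _) + B, 0) := by
  refine .head (mainStep_tick (by simp) (profile_eq_zero.1 hA) fun W Q' h => ?_) (.single ?_)
  · simp [mem_fns] at h
  · have e : (M.control c : Multiset _) + B = (sync, loop c 0) ::ₘ ((M.aux c : Multiset _) + B) := by
      rw [control, ← Multiset.cons_coe, Multiset.cons_add]
    have := mainStep_ev (M := M) (c₀ := c₀) (n := n) (B := 0) (Q := sync) (Q' := loop c 0)
      (A := (M.control c : Multiset _) + B) (by simp) (by simp [e]) (fun t ht hs => by
        rw [e, Multiset.mem_cons, Multiset.mem_add] at ht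
        rcases ht with rfl | ht | ht
        · rfl
        · simp only [aux, Multiset.mem_coe, List.mem_cons, List.mem_replicate] at ht
          rcases ht with rfl | ⟨_, rfl⟩ <;> simp at hs
        · exact absurd hs (profile_eq_zero.1 hB t ht))
    rwa [e, Multiset.erase_cons_head, ← e] at this

theorem profile_regs_sync (k : ℕ) (s : ℕ → ℕ) : profile (M.regs k s) sync = 0 := by
  rw [profile_regs]
  exact Finset.sum_eq_zero fun j _ => by rw [profile_unit_eq_zero] <;> simp

theorem ready_aux_regs {c : Λ} (hc : c ∈ M.controls) (s : ℕ → ℕ) :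
    M.Ready c s ((M.aux c : Multiset _) + M.regs M.bound s) := by
  have hr : ∀ Q : SimState Λ, (∀ c j, Q ≠ SimState.loop c j) → (∀ c, Q ≠ SimState.test c) →
      profile (M.regs M.bound s) Q = 0 := fun Q h₁ h₂ => by
    rw [profile_regs]
    exact Finset.sum_eq_zero fun j _ => by rw [profile_unit_eq_zero j h₁ h₂, mul_zero]
  have ha : ∀ Q, profile (M.aux c) Q = (if SimState.ret c = Q then 1 else 0) +
      if SimState.got c (M.instr c).reg = Q then (M.instr c).sub else 0 := fun Q => by
    simp only [profile, aux, Multiset.coe_countP, List.countP_cons, List.countP_replicate,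
      decide_eq_true_eq]
    rw [add_comm]
  refine ⟨(typed_aux c).add (typed_regs _ _), fun j hj => ?_, fun j hj => ?_, ?_, ?_, ?_, ?_, ?_⟩
  · rw [profile_add, ha, profile_regs, Finset.sum_eq_single j]
    · simp [profile_unit_loop hc]
    · intro i _ hi
      simp [profile_unit_loop hc, hi]
    · simp [hj]
  · rw [profile_add, ha, hr _ (by simp) (by simp)]
    simp [eq_comm]
  · rw [profile_add, ha, profile_regs, Finset.sum_eq_zero]
    · simp
    · intro i hi
      simp [profile_unit_loop hc, (Finset.mem_range.1 hi).ne]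
  · rw [profile_add, ha, profile_regs, Finset.sum_eq_single (M.instr c).reg]
    · simp [profile_unit_test hc]
    · intro i _ hi
      simp [profile_unit_test hc, hi]
    · intro h
      exact absurd (Finset.mem_range.2 (M.reg_lt c hc)) h
  all_goals
    rw [profile_add, ha, hr _ (by simp) (by simp)]
    simp

/-- The copying loops leave the test events of the old units in `A`, so the test sees the register
before the update, as `Instr.next` requires. That the run is nonempty is used in the invariant of
`exists_unitStep_iff`. -/
theorem Ready.transGen {c : Λ} (hc : c ∈ M.controls) {s : ℕ → ℕ} {A} (hA : M.Ready c s A) :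
    TransGen (M.MainStep c₀ n) (SimState.loop c 0, A, 0)
      (SimState.loop ((M.instr c).next s) 0, (M.aux ((M.instr c).next s) : Multiset _) +
        M.regs M.bound ((M.instr c).upd s), 0) := by
  obtain ⟨A₁, h₁, hA₁, hp₁⟩ := hA.exists_loop (c₀ := c₀) (n := n) hc M.bound le_rfl
  have hS := stuck_regs (M := M) c M.bound ((M.instr c).upd s)
  have h₂ := mainStep_phase (c₀ := c₀) (n := n) (A := A₁) hc rfl
    ((hp₁ _ fun j hj => by simp [hj.ne']).trans hA.loop_bound)
    (M.mem_fns.2 (.inr ⟨c, hc, .inr (.inr (.inl ⟨rfl, rfl, rfl⟩))⟩)) (fun W' Q'' h => by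
      rw [mem_fns] at h
      rcases h with ⟨h, -⟩ | ⟨c', hc', ⟨j, hj, h, -⟩ | ⟨j, hj, h, -⟩ | ⟨h, h', h''⟩ | ⟨h, -⟩ |
        ⟨h, -⟩⟩ <;> simp only [reduceCtorEq, SimState.loop.injEq] at h
      · omega
      · exact ⟨h', by rw [h'', h.1]⟩) hS
  refine TransGen.trans_right h₁ (.head h₂ ?_)
  simp only [Multiset.coe_nil, zero_add]
  -- Common end of both branches: the event at `ret c` is still due, which shows that time has not
  -- elapsed in this phase.
  have last : ∀ A' : Multiset (SimState Λ × SimState Λ), Typed A' →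
      profile A' (SimState.ret c) = 1 → profile A' SimState.sync = 0 →
      TransGen (M.MainStep c₀ n)
        (SimState.ret c, A', (M.control ((M.instr c).next s) : Multiset _) +
          M.regs M.bound ((M.instr c).upd s))
        (SimState.loop ((M.instr c).next s) 0, (M.aux ((M.instr c).next s) : Multiset _) +
          M.regs M.bound ((M.instr c).upd s), 0) := by
    intro A' hA' hr hs
    obtain ⟨A'', h, -, -, hp⟩ := exists_mainStep_ev (M := M) (c₀ := c₀) (n := n)
      (B := (M.control ((M.instr c).next s) : Multiset _) + M.regs M.bound ((M.instr c).upd s))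
      (by simp) (by simp) hA' hr
    exact TransGen.head' h (mainStep_enter _ ((hp _ (by simp)).trans hs) (profile_regs_sync _ _))
  have ht := (hp₁ (SimState.test c) (by simp)).trans hA.test
  have hr := (hp₁ (SimState.ret c) (by simp)).trans hA.ret
  have hp := (hp₁ (SimState.pos c) (by simp)).trans hA.pos
  have hs := (hp₁ SimState.sync (by simp)).trans hA.sync
  rcases h0 : s (M.instr c).reg with _ | m
  · rw [h0] at ht
    have h₃ := mainStep_phase (c₀ := c₀) (n := n) (A := A₁) hc rfl ht
      (M.mem_fns.2 (.inr ⟨c, hc, .inr (.inr (.inr (.inl ⟨rfl, rfl, rfl⟩)))⟩)) (fun W' Q'' h => by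
        simpa [mem_fns, hc] using h) hS
    rw [Instr.next_of_zero h0] at last ⊢
    exact .head h₃ (last A₁ hA₁ hr hs)
  · rw [h0] at ht
    obtain ⟨A₂, h₃, hA₂, -, hp₂⟩ := exists_mainStep_ev (M := M) (c₀ := c₀) (n := n)
      (B := M.regs M.bound ((M.instr c).upd s)) (by simp) (by simp) hA₁ ht
    have h₄ := mainStep_phase (c₀ := c₀) (n := n) (A := A₂) hc rfl ((hp₂ _ (by simp)).trans hp)
      (M.mem_fns.2 (.inr ⟨c, hc, .inr (.inr (.inr (.inr ⟨rfl, rfl, rfl⟩)))⟩)) (fun W' Q'' h => by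
        simpa [mem_fns, hc] using h) hS
    rw [Instr.next_of_ne_zero (by omega)] at last ⊢
    exact .head h₃ (.head h₄ (last A₂ hA₂ ((hp₂ _ (by simp)).trans hr)
      ((hp₂ _ (by simp)).trans hs)))

theorem regs_update_zero (n : ℕ) :
    M.regs M.bound (update 0 0 n) = n • (M.unit 0 : Multiset (SimState Λ × SimState Λ)) := by
  rw [regs, Finset.sum_eq_single 0]
  · simp
  · intro j _ hj
    simp [hj]
  · intro h
    exact absurd (Finset.mem_range.2 M.bound_pos) h

theorem start_reflTransGen (c₀ : Λ) (n : ℕ) : ReflTransGen (M.MainStep c₀ n) (init, 0, 0)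
    (loop c₀ 0, (M.aux c₀ : Multiset _) + M.regs M.bound (update 0 0 n), 0) := by
  have h₁ := mainStep_fn (M := M) (c₀ := c₀) (n := n) (A := 0) (B := 0) (by simp) (by simp)
    (M.mem_fns.2 (.inl ⟨rfl, rfl, rfl⟩)) (fun W' Q'' h => by simpa [mem_fns] using h)
    (.inr ⟨rfl, rfl⟩)
  refine .head h₁ ?_
  have h₂ := mainStep_enter (M := M) (c₀ := c₀) (n := n) c₀ (A := 0)
    (B := M.regs M.bound (update 0 0 n)) (by simp [profile]) (profile_regs_sync _ _)
  convert h₂ using 3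
  rw [← Multiset.coe_add, Multiset.coe_flatten_replicate, regs_update_zero, add_zero, add_comm]

theorem next_mem {c : Λ} (hc : c ∈ M.controls) (s : ℕ → ℕ) :
    (M.instr c).next s ∈ M.controls ∨ (M.instr c).next s = M.halt := by
  unfold Instr.next
  split_ifs
  exacts [M.zero_mem c hc, M.pos_mem c hc]

/-- The contract reaches its final state if and only if the counter machine halts. -/
theorem exists_unitStep_iff (hc₀ : c₀ ∈ M.controls) :
    (∃ A B, ReflTransGen (UnitStep (M.fns c₀ n)) (init, 0, 0) (loop M.halt 0, A, B)) ↔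
      ∃ u, ReflTransGen (Instr.Next M.instr M.halt) (c₀, update 0 0 n) (M.halt, u) := by
  have main {x y} (h : ReflTransGen (M.MainStep c₀ n) x y) :
      ReflTransGen (UnitStep (M.fns c₀ n)) x y := ReflTransGen.mono (fun _ _ h => h.1) _ _ h
  constructor
  · rintro ⟨A, B, h⟩
    by_contra hn
    -- If the machine never halts, every reachable configuration is doomed or has a main run to the
    -- start of the phase of some control.
    have inv : ∀ z, ReflTransGen (UnitStep (M.fns c₀ n)) (init, 0, 0) z → M.Doomed z ∨
        ∃ c s A, ReflTransGen (Instr.Next M.instr M.halt) (c₀, update 0 0 n) (c, s) ∧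
          c ∈ M.controls ∧ M.Ready c s A ∧
          ReflTransGen (M.MainStep c₀ n) z (loop c 0, A, 0) := by
      intro z hz
      induction hz with
      | refl => exact .inr ⟨c₀, _, _, .refl, hc₀, ready_aux_regs hc₀ _, start_reflTransGen c₀ n⟩
      | @tail y z _ hyz ih =>
        rcases ih with hd | ⟨c, s, A, hr, hc, hA, hy⟩
        · exact .inl (hd.step hyz)
        -- Appending one whole phase makes the main run nonempty, so that its first step can be
        -- compared with the given step. The next control is not `halt` by `hn`.
        obtain ⟨c', s', A', hr', hc', hA', hy'⟩ : ∃ c s A,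
            ReflTransGen (Instr.Next M.instr M.halt) (c₀, update 0 0 n) (c, s) ∧
            c ∈ M.controls ∧ M.Ready c s A ∧ TransGen (M.MainStep c₀ n) y (loop c 0, A, 0) := by
          have hnext : Instr.Next M.instr M.halt (c, s)
            ((M.instr c).next s, (M.instr c).upd s) := ⟨ne_halt hc, rfl⟩
          rcases next_mem hc s with hm | hm
          · exact ⟨_, _, _, hr.tail hnext, hm, ready_aux_regs hm _,
              TransGen.trans_right hy (hA.transGen hc)⟩
          · exact absurd ⟨_, hm ▸ hr.tail hnext⟩ hn
        obtain ⟨x, hyx, hx⟩ := TransGen.head'_iff.1 hy'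
        rcases hyx.2.2 z hyz with rfl | rfl | hd
        · exact .inr ⟨c', s', A', hr', hc', hA', hx⟩
        · exact .inr ⟨c', s', A', hr', hc', hA', hy'.to_reflTransGen⟩
        · exact .inl hd
    rcases inv _ h with hd | ⟨c, s, A', -, hc, -, hz⟩
    · exact hd.ne rfl
    -- The end of the main run belongs to a control other than `halt`, and no main step starts in
    -- the final state.
    · rcases hz.cases_head with h | ⟨x, hx, -⟩
      · exact ne_halt hc (by simp only [Prod.mk.injEq, loop.injEq] at h; exact h.1.1.symm)
      · exact hx.2.1 rfl
  · rintro ⟨u, h⟩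
    have fwd : ∀ y, ReflTransGen (Instr.Next M.instr M.halt) (c₀, update 0 0 n) y →
        (y.1 ∈ M.controls ∨ y.1 = M.halt) ∧
        ∃ A, ReflTransGen (UnitStep (M.fns c₀ n)) (init, 0, 0) (loop y.1 0, A, 0) ∧
          (y.1 ∈ M.controls → M.Ready y.1 y.2 A) := by
      intro y hy
      induction hy with
      | refl => exact ⟨.inl hc₀, _, main (start_reflTransGen c₀ n), fun h => ready_aux_regs h _⟩
      | tail _ hyz ih =>
        obtain ⟨hm, A, hA, hA'⟩ := ih
        obtain ⟨hne, rfl⟩ := hyz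
        have hc := hm.resolve_right hne
        exact ⟨next_mem hc _, _, hA.trans (main ((hA' hc).transGen hc).to_reflTransGen),
          fun h => ready_aux_regs h _⟩
    obtain ⟨-, A, hA, -⟩ := fwd _ h
    exact ⟨A, 0, hA⟩

end CounterMachine

/-! ### From unit-delay steps to contracts -/

namespace MuStipula

theorem mem_of_mem_layout {l l₀ : ℕ} {F : Fn} {Fs : List Fn} (h : (l, F) ∈ layout l₀ Fs) :
    F ∈ Fs := by
  induction Fs generalizing l₀ with
  | nil => simp [layout] at h
  | cons G Gs ih =>
    simp only [layout, List.mem_cons, Prod.mk.injEq] at h ⊢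
    exact h.imp And.right ih

theorem exists_mem_layout {F : Fn} {Fs : List Fn} (h : F ∈ Fs) (l₀ : ℕ) :
    ∃ l, (l, F) ∈ layout l₀ Fs := by
  induction Fs generalizing l₀ with
  | nil => simp at h
  | cons G Gs ih =>
    rcases List.mem_cons.1 h with rfl | h
    · exact ⟨l₀, by simp [layout]⟩
    · obtain ⟨l, hl⟩ := ih h (l₀ + G.body.length + 2)
      exact ⟨l, List.mem_cons_of_mem _ hl⟩

/-- A pending event without its line-code. -/
def Pending.strip (p : Pending) : ℕ × State × State := (p.time, p.src, p.tgt)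

/-- The effect of a tick on a pending event without line-code. -/
def tickStrip : ℕ × State × State → Option (ℕ × State × State)
  | (0, _) => none
  | (t + 1, p) => some (t, p)

theorem map_strip_down (Ψ : Multiset Pending) :
    (down Ψ).map Pending.strip = (Ψ.map Pending.strip).filterMap tickStrip := by
  rw [down, Multiset.map_filterMap, Multiset.filterMap_map]
  congr 1
  funext ⟨t, n, Q, Q'⟩
  cases t <;> rfl

/-- Execute the pending state change, if any. -/
def Config.flush : Config → Config
  | ⟨Q, none, Ψ⟩ => ⟨Q, none, Ψ⟩
  | ⟨_, some (Ψ', Q'), Ψ⟩ => ⟨Q', none, Ψ' + Ψ⟩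

section Encoding

variable {σ : Type*} (e : σ → State)

/-- The event of delay `1` for a pair of states. -/
def unitEvent (t : σ × σ) : Event := ⟨1, e t.1, e t.2⟩

/-- The function, with a given name, whose events have delay `1`. -/
def unitFn (p : (σ × List (σ × σ) × σ) × FName) : Fn :=
  ⟨e p.1.1, p.2, p.1.2.1.map (unitEvent e), e p.1.2.2⟩

/-- The contract with distinct function names whose events have delay `1`. -/
def unitContract (q : σ) (F : List (σ × List (σ × σ) × σ)) : Contract :=
  ⟨e q, F.zipIdx.map (unitFn e)⟩

theorem unitContract_wellFormed (q : σ) (F : List (σ × List (σ × σ) × σ)) :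
    (unitContract e q F).WellFormed := by
  have h : ((F.zipIdx.map (unitFn e)).map fun G => (G.src, G.name, G.tgt)).map (fun p => p.2.1) =
      F.zipIdx.map Prod.snd := by
    rw [List.map_map, List.map_map]; rfl
  refine List.Nodup.of_map (fun p => p.2.1) ?_
  rw [unitContract, h, List.zipIdx_map_snd]
  exact List.nodup_range'

theorem unitContract_timeAhead (q : σ) (F : List (σ × List (σ × σ) × σ)) :
    (unitContract e q F).TimeAhead := by
  intro G hG ev hev
  obtain ⟨p, _, rfl⟩ := List.mem_map.1 hG
  obtain ⟨t, _, rfl⟩ := List.mem_map.1 hev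
  exact one_pos

theorem exists_of_mem_functions {q : σ} {F : List (σ × List (σ × σ) × σ)} {G : Fn}
    (h : G ∈ (unitContract e q F).functions) : ∃ p ∈ F, ∃ i, G = unitFn e (p, i) := by
  obtain ⟨⟨p, i⟩, hp, rfl⟩ := List.mem_map.1 h
  exact ⟨p, List.fst_mem_of_mem_zipIdx hp, i, rfl⟩

theorem exists_mem_functions {q : σ} {F : List (σ × List (σ × σ) × σ)}
    {p : σ × List (σ × σ) × σ} (h : p ∈ F) :
    ∃ i, unitFn e (p, i) ∈ (unitContract e q F).functions := by
  obtain ⟨i, hi, rfl⟩ := List.getElem_of_mem h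
  exact ⟨i, List.mem_map_of_mem (List.mk_mem_zipIdx_iff_getElem?.2 (by simp))⟩

/-- A stripped pending event with a given time. -/
def stripOf (k : ℕ) (t : σ × σ) : ℕ × State × State := (k, e t.1, e t.2)

theorem map_strip_lineCode (l : ℕ) (W : List (σ × σ)) :
    (lineCode l (W.map (unitEvent e))).map Pending.strip =
      (W : Multiset (σ × σ)).map (stripOf e 1) := by
  have h : ∀ V : List Event, (V.zipIdx (l + 1)).map (Pending.strip ∘ fun p =>
      (⟨p.1.delay, p.2, p.1.src, p.1.tgt⟩ : Pending)) =
        V.map fun v => (v.delay, v.src, v.tgt) := fun V => by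
    conv_rhs => rw [← List.zipIdx_map_fst (l + 1) V, List.map_map]
    rfl
  rw [lineCode, Multiset.map_coe, List.map_map, h, List.map_map, Multiset.map_coe]
  rfl

/-- A configuration without continuation represents pairs of states of times `0` and `1`. -/
def Represents (c : Config) (x : σ × Multiset (σ × σ) × Multiset (σ × σ)) : Prop :=
  c.cont = none ∧ c.state = e x.1 ∧
    c.pending.map Pending.strip = x.2.1.map (stripOf e 0) + x.2.2.map (stripOf e 1)

variable {e}

theorem noRed_iff (he : Injective e) {Ψ : Multiset Pending} {A B : Multiset (σ × σ)} {Q : σ}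
    (h : Ψ.map Pending.strip = A.map (stripOf e 0) + B.map (stripOf e 1)) :
    NoRed Ψ (e Q) ↔ ∀ t ∈ A, t.1 ≠ Q := by
  constructor
  · rintro hn t ht rfl
    have : stripOf e 0 t ∈ Ψ.map Pending.strip := by
      rw [h]; exact Multiset.mem_add.2 (.inl (Multiset.mem_map_of_mem _ ht))
    obtain ⟨p, hp, hpt⟩ := Multiset.mem_map.1 this
    simp only [Pending.strip, stripOf, Prod.mk.injEq] at hpt
    exact hn p hp ⟨hpt.1, hpt.2.1⟩
  · rintro hn p hp ⟨h0, hs⟩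
    have : p.strip ∈ A.map (stripOf e 0) + B.map (stripOf e 1) :=
      h ▸ Multiset.mem_map_of_mem _ hp
    simp only [Multiset.mem_add, Multiset.mem_map, Pending.strip, stripOf, Prod.mk.injEq, h0,
      hs] at this
    rcases this with ⟨t, ht, -, h, -⟩ | ⟨t, -, h, -⟩
    · exact hn t ht (he h)
    · exact one_ne_zero h

theorem map_strip_down_eq {Ψ : Multiset Pending} {A B : Multiset (σ × σ)}
    (h : Ψ.map Pending.strip = A.map (stripOf e 0) + B.map (stripOf e 1)) :
    (down Ψ).map Pending.strip = B.map (stripOf e 0) := by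
  rw [map_strip_down, h, Multiset.filterMap_add, Multiset.filterMap_map, Multiset.filterMap_map]
  have h₁ : (tickStrip ∘ stripOf e 0) = fun _ => none := rfl
  have h₂ : (tickStrip ∘ stripOf e 1) = fun t => some (stripOf e 0 t) := rfl
  have h₃ : A.filterMap (fun _ => (none : Option (ℕ × State × State))) = 0 :=
    Multiset.eq_zero_of_forall_notMem fun a ha => by simp at ha
  rw [h₁, h₂, h₃, zero_add]
  exact congrFun (Multiset.filterMap_eq_map (stripOf e 0)) B

variable {q : σ} {F : List (σ × List (σ × σ) × σ)}

theorem Represents.exists_steps (he : Injective e) {c : Config} {t : ℕ} {x y}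
    (hx : Represents e c x) (h : UnitStep F x y) :
    ∃ c' t', (unitContract e q F).Steps (c, t) (c', t') ∧ Represents e c' y := by
  obtain ⟨Q, cont, Ψ⟩ := c
  obtain ⟨rfl, hQ, hΨ⟩ := hx
  simp only at hQ hΨ
  subst hQ
  cases h with
  | @fn Q W Q' A B hf hn =>
    obtain ⟨i, hi⟩ := exists_mem_functions (e := e) (q := q) hf
    obtain ⟨l, hl⟩ := exists_mem_layout hi 3
    refine ⟨_, t, .head ⟨_, .function hl ((noRed_iff he hΨ).2 hn)⟩ (.single ⟨_, .stateChange⟩),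
      rfl, rfl, ?_⟩
    simp only [Multiset.map_add, hΨ, unitFn, map_strip_lineCode]
    exact add_left_comm _ _ _
  | @ev Q Q' A B =>
    have : stripOf e 0 (Q, Q') ∈ Ψ.map Pending.strip := by
      rw [hΨ]; simp
    obtain ⟨⟨k, n, P, P'⟩, hp, hpt⟩ := Multiset.mem_map.1 this
    obtain ⟨Ψ', rfl⟩ := Multiset.exists_cons_of_mem hp
    simp only [Pending.strip, stripOf, Prod.mk.injEq] at hpt
    obtain ⟨rfl, rfl, rfl⟩ := hpt
    refine ⟨_, t, .head ⟨_, .eventMatch⟩ (.single ⟨_, .stateChange⟩), rfl, rfl, ?_⟩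
    simpa [Pending.strip, stripOf] using hΨ
  | @tick Q A B hn =>
    refine ⟨_, t + 1, .single ⟨_, .tick ((noRed_iff he hΨ).2 hn)⟩, rfl, rfl, ?_⟩
    simp [map_strip_down_eq hΨ]

/-- Flushing credits the whole unit step to the transition that installs the continuation; the state
change that follows then corresponds to no step. -/
theorem Represents.exists_unitStep (he : Injective e) {c c' : Config × ℕ} {μ : Label} {x}
    (hx : Represents e c.1.flush x) (h : Step (unitContract e q F) c μ c') :
    ∃ y, ReflTransGen (UnitStep F) x y ∧ Represents e c'.1.flush y := by
  obtain ⟨Q, A, B⟩ := x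
  obtain ⟨-, hQ, hΨ⟩ := hx
  cases h with
  | @function l G Ψ t hl hn =>
    obtain ⟨⟨Q₁, W, Q₂⟩, hp, i, rfl⟩ := exists_of_mem_functions e (mem_of_mem_layout hl)
    obtain rfl : Q₁ = Q := he hQ
    refine ⟨_, .single (.fn hp ((noRed_iff he hΨ).1 hn)), rfl, rfl, ?_⟩
    simp only [Config.flush] at hΨ ⊢
    simp only [Multiset.map_add, hΨ, unitFn, map_strip_lineCode]
    exact add_left_comm _ _ _
  | stateChange => exact ⟨_, .refl, rfl, hQ, hΨ⟩
  | @eventMatch Q₁ Q' n Ψ' t =>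
    simp only [Config.flush] at hQ hΨ
    have : (0, Q₁, Q') ∈ A.map (stripOf e 0) + B.map (stripOf e 1) := by
      rw [← hΨ]; simp [Pending.strip]
    simp only [Multiset.mem_add, Multiset.mem_map, stripOf, Prod.mk.injEq, one_ne_zero, false_and,
      and_false, exists_false, or_false, true_and] at this
    obtain ⟨⟨a, b⟩, hab, h₁, rfl⟩ := this
    obtain rfl : a = Q := he (h₁.trans hQ)
    obtain ⟨A', rfl⟩ := Multiset.exists_cons_of_mem hab
    subst hQ
    refine ⟨_, .single .ev, rfl, rfl, ?_⟩
    simpa [Config.flush, Pending.strip, stripOf] using hΨ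
  | tick hn =>
    simp only [Config.flush] at hQ hΨ
    subst hQ
    refine ⟨_, .single (.tick ((noRed_iff he hΨ).1 hn)), rfl, rfl, ?_⟩
    simp [Config.flush, map_strip_down_eq hΨ]

theorem reachable_unitContract (he : Injective e) {Q : σ} :
    (unitContract e q F).Reachable (e Q) ↔
      ∃ A B, ReflTransGen (UnitStep F) (q, 0, 0) (Q, A, B) := by
  have h0 : Represents e (unitContract e q F).initial (q, 0, 0) := ⟨rfl, rfl, rfl⟩
  constructor
  · rintro ⟨Ψ, t, h⟩
    have key : ∀ c, (unitContract e q F).Steps ((unitContract e q F).initial, 0) c →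
        ∃ y, ReflTransGen (UnitStep F) (q, 0, 0) y ∧ Represents e c.1.flush y := by
      intro c hc
      induction hc with
      | refl => exact ⟨_, .refl, h0⟩
      | tail _ h ih =>
        obtain ⟨y, hy, hr⟩ := ih
        obtain ⟨μ, h⟩ := h
        obtain ⟨z, hz, hr'⟩ := hr.exists_unitStep he h
        exact ⟨z, hy.trans hz, hr'⟩
    obtain ⟨⟨Q', A, B⟩, hy, -, hQ, -⟩ := key _ h
    obtain rfl : Q = Q' := he hQ
    exact ⟨A, B, hy⟩
  · rintro ⟨A, B, h⟩
    have key : ∀ y, ReflTransGen (UnitStep F) (q, 0, 0) y → ∃ c t,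
        (unitContract e q F).Steps ((unitContract e q F).initial, 0) (c, t) ∧
          Represents e c y := by
      intro y hy
      induction hy with
      | refl => exact ⟨_, 0, .refl, h0⟩
      | tail _ h ih =>
        obtain ⟨c, t, hc, hr⟩ := ih
        obtain ⟨c', t', hc', hr'⟩ := hr.exists_steps (q := q) (t := t) he h
        exact ⟨c', t', hc.trans hc', hr'⟩
    obtain ⟨⟨Q', cont, Ψ⟩, t, hc, rfl, hQ, -⟩ := key _ h
    obtain rfl : Q' = e Q := hQ
    exact ⟨Ψ, t, hc⟩

end Encoding

/-! ### Computability of the reduction -/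

theorem primrec_event_flatten_replicate (U : List Event) :
    Primrec fun n : ℕ => (List.replicate n U).flatten := by
  refine (Primrec.nat_rec₁ (f := fun _ l => U ++ l) [] ?_).of_eq fun n => ?_
  · exact Primrec.list_append.comp (Primrec.const U) Primrec.snd
  · induction n with
    | zero => rfl
    | succ n ih => rw [List.replicate_succ, List.flatten_cons, ← ih]

/-- Contracts that differ only in the repetitions of a list of events in the first function. -/
theorem primrec_contract (U D : List Event) (q q' : State) (Fs : List Fn) :
    Primrec fun n : ℕ =>
      (⟨q, ⟨q, 0, (List.replicate n U).flatten ++ D, q'⟩ :: Fs⟩ : Contract) := by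
  have hb := Primrec.list_append.comp (primrec_event_flatten_replicate U)
    (Primrec.const (α := ℕ) D)
  have hf : Primrec fun n : ℕ => (⟨q, 0, (List.replicate n U).flatten ++ D, q'⟩ : Fn) :=
    (Primrec.of_equiv_symm (e := Fn.equiv)).comp ((Primrec.const q).pair
      ((Primrec.const 0).pair (hb.pair (Primrec.const q'))))
  exact (Primrec.of_equiv_symm (e := Contract.equiv)).comp ((Primrec.const q).pair
    (Primrec.list_cons.comp hf (Primrec.const Fs)))

end MuStipula

theorem SimState.countable {Λ : Type*} [Inhabited Λ] [Countable Λ] : Countable (SimState Λ) := by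
  let f : SimState Λ → ℕ × Λ × ℕ
    | .init => (0, default, 0)
    | .sync => (1, default, 0)
    | .ret c => (2, c, 0)
    | .loop c j => (3, c, j)
    | .got c j => (4, c, j)
    | .test c => (5, c, 0)
    | .pos c => (6, c, 0)
  refine Injective.countable (f := f) fun x y h => ?_
  cases x <;> cases y <;> simp_all [f]

/-- The counter machine of a program. -/
noncomputable def Prog.machine (P : Prog) : CounterMachine (List Prog) where
  instr := Prog.instr
  controls := (P.support []).toList
  bound := (P.support []).sup (fun c => (Prog.instr c).reg) + 1
  halt := []
  nodup := Finset.nodup_toList _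
  halt_notMem h := Prog.ne_nil_of_mem_support (Finset.mem_toList.1 h) rfl
  reg_lt c hc := Nat.lt_succ_of_le
    (Finset.le_sup (f := fun c => (Prog.instr c).reg) (Finset.mem_toList.1 hc))
  bound_pos := Nat.succ_pos _
  zero_mem c hc := by
    simpa using (Prog.next_mem_support P [] c (Finset.mem_toList.1 hc)).1
  pos_mem c hc := by
    simpa using (Prog.next_mem_support P [] c (Finset.mem_toList.1 hc)).2
  zero_ne _ hc := (Prog.next_ne (Prog.ne_nil_of_mem_support (Finset.mem_toList.1 hc))).1
  pos_ne _ hc := (Prog.next_ne (Prog.ne_nil_of_mem_support (Finset.mem_toList.1 hc))).2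

/-- There is a partial recursive function on `ℕ` whose domain is not computable. -/
theorem exists_partrec_dom_not_computable :
    ∃ f : ℕ →. ℕ, Partrec f ∧ ¬ ComputablePred fun n => (f n).Dom := by
  refine ⟨fun n => (Denumerable.ofNat Nat.Partrec.Code n).eval 0,
    Nat.Partrec.Code.eval_part.comp (Computable.ofNat _) (Computable.const 0), fun h => ?_⟩
  refine ComputablePred.halting_problem 0 ?_
  refine ComputablePred.computable_of_manyOneReducible
    ⟨fun c => Encodable.encode c, Computable.encode, fun c => ?_⟩ h
  simp

/-- The algorithm may diverge outside `D`, but its composition with `g` is total and always right.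
-/
theorem MuStipula.DecidableOn.computablePred {α : Type*} [Primcodable α] {D p : α → Prop}
    (h : DecidableOn D p) {g : ℕ → α} (hg : Computable g) (hD : ∀ n, D (g n)) :
    ComputablePred fun n => p (g n) := by
  obtain ⟨f, hf, hfD⟩ := h
  choose b hb hbp using fun n => hfD (g n) (hD n)
  have hc : Computable b := (hf.comp hg).of_eq fun n => Part.eq_some_iff.2 (hb n)
  exact ComputablePred.computable_iff.2 ⟨b, hc, funext fun n => propext (hbp n).symm⟩

theorem mainTheorem2 :
    ¬ MuStipula.DecidableOn
      (fun x : MuStipula.Contract × MuStipula.State => x.1.WellFormed ∧ x.1.TimeAhead)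
      (fun x => x.1.Reachable x.2) := by
  intro hdec
  obtain ⟨f, hf, hnf⟩ := exists_partrec_dom_not_computable
  obtain ⟨P, hP⟩ := Prog.exists_prog_dom hf
  have : Countable (SimState (List Prog)) := SimState.countable
  obtain ⟨e, he⟩ := exists_injective_nat (SimState (List Prog))
  let M := P.machine
  have hM : [P] ∈ M.controls := Finset.mem_toList.2 (Prog.mem_support_self P [])
  -- The encoding `e` and the machine `M` are arbitrary choices independent of `n`. They enter `g`
  -- only through finitely many constants, so they need not be computable.
  let g : ℕ → MuStipula.Contract × MuStipula.State := fun n =>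
    (MuStipula.unitContract e .init (M.fns [P] n), e (.loop M.halt 0))
  have hg : Computable g := by
    refine Computable.pair (Primrec.to_comp ?_) (Computable.const _)
    refine (MuStipula.primrec_contract ((M.unit 0).map (MuStipula.unitEvent e))
      ((M.control [P]).map (MuStipula.unitEvent e)) (e .init) (e .sync)
      -- The initial function has name `0`, so the names of the others start at `1`.
      (((M.controls.flatMap M.phaseFns).zipIdx 1).map (MuStipula.unitFn e))).of_eq fun n => ?_
    simp [MuStipula.unitContract, CounterMachine.fns, MuStipula.unitFn, List.map_flatten]
  refine hnf ((hdec.computablePred hg fun n => ⟨MuStipula.unitContract_wellFormed _ _ _,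
    MuStipula.unitContract_timeAhead _ _ _⟩).of_eq fun n => ?_)
  rw [← hP n, Prog.exists_exec_iff]
  exact (MuStipula.reachable_unitContract he).trans (M.exists_unitStep_iff hM)
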